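/- **Theorem.** Let $P_n$ denote the path with $n$ vertices and let $\square$ denote the Cartesian product of graphs. Given a finite graph $G$ and a nonnegative integer $k$, in the *$k$-coloring game* on $G$ two players, Alice and Bob, alternate moves with Alice moving first. A move consists in choosing an uncolored vertex $v$ and assigning to it a color from $\{1,\dots,k\}$ that is not the color of any already colored neighbor of $v$. The game stops when no such move is possible. Alice wins if all vertices of $G$ are then colored; otherwise Bob wins. The *game chromatic number* $\chi_g(G)$ is the smallest $k$ such that Alice has a winning strategy in the $k$-coloring game on $G$. For every $n\ge 1$, Alice has a winning strategy in the $4$-coloring game on the $4\times n$ grid $P_4\square P_n$; in particular $\chi_g(P_4\square P_n)\le 4$. Moreover, $\chi_g(P_4\square P_n)=4$ for every $n\ge 18$. -/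

import Mathlib

/-- A history of the `k`-coloring game on vertex set `V`: the list of all moves made so far, the
most recent move first. A move `(v, i)` assigns the color `i` to the vertex `v`. -/
abbrev ColoringGame.History (V : Type*) (k : ℕ) : Type _ := List (V × Fin k)

/-- The partial coloring produced by a history (`none` means that the vertex is uncolored). -/
def ColoringGame.coloring {V : Type*} [DecidableEq V] {k : ℕ} :
    ColoringGame.History V k → V → Option (Fin k)
  | [] => fun _ => none
  | m :: h => Function.update (ColoringGame.coloring h) m.1 (some m.2)

/-- The move `m = (v, i)` is legal after the history `h`: the vertex `v` is uncolored, and no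
neighbor of `v` has color `i`. -/
def ColoringGame.IsLegal {V : Type*} [DecidableEq V] (G : SimpleGraph V) {k : ℕ}
    (h : ColoringGame.History V k) (m : V × Fin k) : Prop :=
  ColoringGame.coloring h m.1 = none ∧
    ∀ u : V, G.Adj m.1 u → ColoringGame.coloring h u ≠ some m.2

/-- A strategy for Alice: to every history that admits a legal move it assigns a legal move. -/
def ColoringGame.Strategy {V : Type*} [DecidableEq V] (G : SimpleGraph V) (k : ℕ) : Type _ :=
  ∀ h : ColoringGame.History V k, (∃ m, ColoringGame.IsLegal G h m) →
    {m : V × Fin k // ColoringGame.IsLegal G h m}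

/-- The histories that can arise when Alice moves first, the players alternate, Alice follows the
strategy `σ`, and Bob makes arbitrary legal moves. Alice is to move exactly when the number of
moves made so far is even. -/
inductive ColoringGame.IsPlay {V : Type*} [DecidableEq V] (G : SimpleGraph V) {k : ℕ}
    (σ : ColoringGame.Strategy G k) : ColoringGame.History V k → Prop
  | start : ColoringGame.IsPlay G σ []
  | alice (h : ColoringGame.History V k) (hm : ∃ m, ColoringGame.IsLegal G h m) :
      ColoringGame.IsPlay G σ h → Even h.length →
        ColoringGame.IsPlay G σ ((σ h hm).1 :: h)
  | bob (h : ColoringGame.History V k) (m : V × Fin k) :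
      ColoringGame.IsPlay G σ h → Odd h.length → ColoringGame.IsLegal G h m →
        ColoringGame.IsPlay G σ (m :: h)

/-- The strategy `σ` is winning for Alice: whatever Bob does, whenever the game stops because no
legal move is left, all vertices are colored. (On a finite graph every play stops.) -/
def ColoringGame.Strategy.IsWinning {V : Type*} [DecidableEq V] {G : SimpleGraph V} {k : ℕ}
    (σ : ColoringGame.Strategy G k) : Prop :=
  ∀ h : ColoringGame.History V k, ColoringGame.IsPlay G σ h →
    (∀ m : V × Fin k, ¬ ColoringGame.IsLegal G h m) →
      ∀ v : V, ColoringGame.coloring h v ≠ none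

/-- Alice, who moves first, has a winning strategy in the `k`-coloring game on the finite
graph `G`. -/
def AliceWinsColoringGame {V : Type*} [Fintype V] [DecidableEq V] (G : SimpleGraph V)
    (k : ℕ) : Prop :=
  ∃ σ : ColoringGame.Strategy G k, σ.IsWinning

/-- The game chromatic number: the smallest `k` such that Alice has a winning strategy in the
`k`-coloring game on `G`. -/
noncomputable def gameChromaticNumber {V : Type*} [Fintype V] [DecidableEq V]
    (G : SimpleGraph V) : ℕ :=
  sInf {k : ℕ | AliceWinsColoringGame G k}

/-! ### Positions on the strip: the column types and Alice's invariant. -/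

namespace GridGame

/-! Upper bound. Outer vertices have at most three neighbors, so with four colors only the two
middle rows are in danger. An inner vertex with two equally colored neighbors, or in the end column
0, is safe, and stays so (`Safe.mono`). After each of her moves Alice keeps every column empty,
`Solid`, `Guarded` or `Enclosed`. The uncolored inner vertices of a solid column are safe. In the
last two types one inner vertex may be unsafe, but it can still be colored, and Alice can color it
at once after any move of Bob that endangers it. Two statements carry the strategy: Alice can
restore the invariant after every move of Bob (`Inv.answer`), and from the invariant she always has
a harmless extra move (`Inv.exists_move`), needed for the opening and whenever Bob's move damages
nothing.

The clauses of `Solid` about empty neighbors come from the need to open empty columns. Opening one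
next to a full column works unless both its neighbors are `Perfect` (`exists_reply_of_emp`); hence
no solid column bordering an empty one may be perfect. If Bob perfects such a column, Alice opens
its empty neighbor. She could not do this on two sides, so a full column between two empty ones must
be immune (`Broken`) or have both outer vertices free, letting Alice break it in reply. The clause
`half` provides for the same when the missing inner vertex is colored later.

Lower bound. With three colors Bob colors a vertex `p` far from Alice's first move. Whatever she
replies, some `r` at distance two shares two neighbors with `p`. Coloring `r` differently leaves
both with one possible color, and Bob can take it away at two places too far apart for Alice to
parry both (`not_double_threat`). Ten columns suffice. -/

/-- Partial colorings of the two-sided strip: the first argument tells inner (`true`) from outer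
(`false`) vertices, the second one the side, the third one the column. -/
abbrev Board := Bool → Bool → ℤ → Option (Fin 4)

/-- The column `k` exists. -/
def In (n k : ℤ) : Prop := 0 ≤ k ∧ k < n

/-- The column `k` exists and is uncolored. -/
def Emp (F : Board) (n k : ℤ) : Prop := In n k ∧ ∀ b s, F b s k = none

/-- Some inner vertex of column `k` is colored. -/
def HasMid (F : Board) (k : ℤ) : Prop := ∃ s, F true s k ≠ none

/-- Both inner vertices of column `k` are colored. -/
def FullMid (F : Board) (k : ℤ) : Prop := ∀ s, F true s k ≠ none

/-- Two entries carry the same color. -/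
def Same (u v : Option (Fin 4)) : Prop := u = v ∧ u ≠ none

/-- The inner vertex on side `s` of column `k` has at most three neighbors, or two neighbors of the
same color. -/
def Safe (F : Board) (s : Bool) (k : ℤ) : Prop :=
  k = 0 ∨ Same (F false s k) (F true (!s) k) ∨ Same (F false s k) (F true s (k + 1)) ∨
    Same (F false s k) (F true s (k - 1)) ∨ Same (F true (!s) k) (F true s (k + 1)) ∨
    Same (F true (!s) k) (F true s (k - 1)) ∨ Same (F true s (k + 1)) (F true s (k - 1))

/-- Some outer vertex of column `k` has a color that is not used by the inner ones. -/
def Broken (F : Board) (k : ℤ) : Prop := ∃ s, F false s k ≠ none ∧ ∀ t, F false s k ≠ F true t k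

/-- The column `k` is colored alternately with two colors. -/
def Perfect (F : Board) (k : ℤ) : Prop := ∀ s, F false s k ≠ none ∧ F false s k = F true (!s) k

/-- A column with a colored inner vertex whose uncolored inner vertex, if any, is safe. -/
structure Solid (F : Board) (n k : ℤ) : Prop where
  hasMid : HasMid F k
  safe : ∀ s, F true s k = none → Safe F s k
  broken : FullMid F k → Emp F n (k + 1) → Emp F n (k - 1) →
    Broken F k ∨ ∀ s, F false s k = none
  half : ∀ s e, e = 1 ∨ e = -1 → F true s k = none → Emp F n (k + e) →
    (F false (!s) k = none ∨ F false (!s) k = F false s k) ∧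
      (F false s k = F true (!s) k ∨ ¬ In n (k - e) ∨ HasMid F (k - e))
  perfect : ∀ e, e = 1 ∨ e = -1 → Emp F n (k + e) → ¬ Perfect F k

/-- A column with equal outer colors and uncolored inner vertices, the one on side `s` being
endangered only by its partner and by its uncolored neighbor in the solid column `k + e`. -/
structure Guarded (F : Board) (n k : ℤ) (s : Bool) (e : ℤ) : Prop where
  dir : e = 1 ∨ e = -1
  mid : ∀ t, F true t k = none
  out : F false true k ≠ none ∧ F false true k = F false false k
  safe : Safe F (!s) k
  support : F true s (k + e) = none
  colored : F true (!s) (k + e) ≠ none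
  beyond : ¬ In n (k + 2 * e) ∨ HasMid F (k + 2 * e)

/-- A column with uncolored inner vertices enclosed by columns with colored inner vertices; only the
inner vertex on side `!s` may be endangered. -/
structure Enclosed (F : Board) (k : ℤ) (s : Bool) : Prop where
  mid : ∀ t, F true t k = none
  next : FullMid F (k + 1)
  prev : FullMid F (k - 1)
  safe : Safe F s k
  out : F false (!s) k = none

/-- The admissible columns. -/
def Good (F : Board) (n k : ℤ) : Prop :=
  Emp F n k ∨ Solid F n k ∨ (∃ s e, Guarded F n k s e) ∨ ∃ s, Enclosed F k s

/-- It is legal to give the color `x` to the vertex `(b, s, k)`. -/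
structure Leg (F : Board) (n : ℤ) (b s : Bool) (k : ℤ) (x : Fin 4) : Prop where
  mem : In n k
  free : F b s k = none
  next : F b s (k + 1) ≠ some x
  prev : F b s (k - 1) ≠ some x
  cross : F (!b) s k ≠ some x
  across : b = true → F true (!s) k ≠ some x

/-- The board after coloring a vertex. -/
def play (F : Board) (b s : Bool) (k : ℤ) (x : Fin 4) : Board :=
  fun b' s' k' => if b' = b ∧ s' = s ∧ k' = k then some x else F b' s' k'

/-- The board is a proper partial coloring of the existing columns. -/
structure Proper (F : Board) (n : ℤ) : Prop where
  next : ∀ b s k, F b s k ≠ none → F b s k ≠ F b s (k + 1)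
  cross : ∀ b s k, F b s k ≠ none → F b s k ≠ F (!b) s k
  across : ∀ s k, F true s k ≠ none → F true s k ≠ F true (!s) k
  outside : ∀ b s k, ¬ In n k → F b s k = none

/-- Alice's invariant. -/
structure Inv (F : Board) (n : ℤ) : Prop where
  proper : Proper F n
  good : ∀ k, In n k → Good F n k

/-! ### Persistence of the column types under moves, and tools for building them. -/

theorem exists_color (u v w : Option (Fin 4)) :
    ∃ x : Fin 4, u ≠ some x ∧ v ≠ some x ∧ w ≠ some x := by
  revert u v w; decide

theorem Same.symm {u v : Option (Fin 4)} (h : Same u v) : Same v u :=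
  ⟨h.1.symm, h.1 ▸ h.2⟩

theorem play_self (F : Board) (b s k x) : play F b s k x b s k = some x := by simp [play]

theorem play_of_ne_col {F : Board} {b s k x b' s' k'} (h : k' ≠ k) :
    play F b s k x b' s' k' = F b' s' k' := by simp [play, h]

theorem play_of_ne {F : Board} {b s k x b' s' k'} (h : ¬ (b' = b ∧ s' = s ∧ k' = k)) :
    play F b s k x b' s' k' = F b' s' k' := by simp [play, h]

theorem play_mono {F : Board} {n b s k x} (h : Leg F n b s k x) (b' s' k')
    (h' : F b' s' k' ≠ none) : play F b s k x b' s' k' = F b' s' k' := by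
  apply play_of_ne
  rintro ⟨rfl, rfl, rfl⟩
  exact h' h.free

theorem play_eq_none {F : Board} {b s k x b' s' k'} (h : play F b s k x b' s' k' = none) :
    F b' s' k' = none := by
  unfold play at h; split_ifs at h; exact h

theorem Same.mono {F F' : Board} (h : ∀ b s k, F b s k ≠ none → F' b s k = F b s k)
    {b s k b' s' k'} (hs : Same (F b s k) (F b' s' k')) : Same (F' b s k) (F' b' s' k') := by
  have h1 := h _ _ _ hs.2
  have h2 := h _ _ _ hs.symm.2
  unfold Same at *; rw [h1, h2]; exact hs

theorem Safe.mono {F F' : Board} (h : ∀ b s k, F b s k ≠ none → F' b s k = F b s k) {s k}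
    (hs : Safe F s k) : Safe F' s k := by
  rcases hs with hs | hs | hs | hs | hs | hs | hs
  · exact Or.inl hs
  all_goals have := hs.mono h; simp only [Safe, this, true_or, or_true]

theorem Proper.play {F : Board} {n b s k x} (hF : Proper F n) (h : Leg F n b s k x) :
    Proper (play F b s k x) n := by
  obtain ⟨h1, h2, h3, h4, h5, h6⟩ := h
  obtain ⟨p1, p2, p3, p4⟩ := hF
  constructor
  · intro b' s' k'
    have := p1 b' s' k'
    clear p1 p2 p3 p4
    unfold GridGame.play
    grind
  · intro b' s' k'
    have := p2 b' s' k'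
    clear p1 p2 p3 p4
    unfold GridGame.play
    cases b' <;> cases b <;> grind
  · intro s' k'
    have := p3 s' k'
    clear p1 p2 p3 p4
    unfold GridGame.play
    cases s' <;> cases s <;> grind
  · intro b' s' k' hk
    rw [play_of_ne (by rintro ⟨rfl, rfl, rfl⟩; exact hk h1)]
    exact p4 _ _ _ hk

theorem HasMid.play {F : Board} {n b s j x k} (h : Leg F n b s j x) (hk : HasMid F k) :
    HasMid (play F b s j x) k :=
  hk.imp fun s hs => by rwa [play_mono h _ _ _ hs]

theorem FullMid.play {F : Board} {n b s j x k} (h : Leg F n b s j x) (hk : FullMid F k) :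
    FullMid (play F b s j x) k :=
  fun s => by rw [play_mono h _ _ _ (hk s)]; exact hk s

theorem Emp.of_play {F : Board} {n b s j x k} (h : Emp (GridGame.play F b s j x) n k) :
    Emp F n k ∧ k ≠ j :=
  ⟨⟨h.1, fun _ _ => play_eq_none (h.2 _ _)⟩, by
    rintro rfl; have := h.2 b s; rw [play_self] at this; cases this⟩

/-- Moves elsewhere can only help: safety and colored neighbors persist, and empty neighbors, the
premises of the other clauses, can only disappear. -/
theorem Solid.play_ne {F : Board} {n b s j x k} (h : Leg F n b s j x) (hk : Solid F n k)
    (hkj : k ≠ j) : Solid (play F b s j x) n k := by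
  have hc : ∀ b' s', GridGame.play F b s j x b' s' k = F b' s' k := fun _ _ => play_of_ne_col hkj
  constructor
  · exact hk.hasMid.play h
  · intro t ht
    rw [hc] at ht
    exact (hk.safe t ht).mono (play_mono h)
  · intro hf h1 h2
    simp only [Broken, hc]
    exact hk.broken (fun t => by simpa only [hc] using hf t) h1.of_play.1 h2.of_play.1
  · intro t e he ht h1
    simp only [hc] at ht ⊢
    have := hk.half t e he ht h1.of_play.1
    refine ⟨this.1, this.2.imp id (Or.imp id fun h' => h'.play h)⟩
  · intro e he h1
    simp only [Perfect, hc]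
    exact hk.perfect e he h1.of_play.1

theorem Guarded.play_ne {F : Board} {n b s j x k t e} (h : Leg F n b s j x)
    (hk : Guarded F n k t e) (hkj : k ≠ j) (hs : ¬ (b = true ∧ s = t ∧ j = k + e)) :
    Guarded (play F b s j x) n k t e := by
  have hc : ∀ b' s', GridGame.play F b s j x b' s' k = F b' s' k := fun _ _ => play_of_ne_col hkj
  refine ⟨hk.dir, fun t => by rw [hc, hk.mid], by simp only [hc]; exact hk.out,
    hk.safe.mono (play_mono h), ?_, ?_, hk.beyond.imp id fun h' => h'.play h⟩
  · rw [play_of_ne (by grind), hk.support]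
  · rw [play_mono h _ _ _ hk.colored]; exact hk.colored

theorem Enclosed.play_ne {F : Board} {n b s j x k t} (h : Leg F n b s j x)
    (hk : Enclosed F k t) (hkj : k ≠ j) : Enclosed (play F b s j x) k t := by
  have hc : ∀ b' s', GridGame.play F b s j x b' s' k = F b' s' k := fun _ _ => play_of_ne_col hkj
  exact ⟨fun t => by rw [hc, hk.mid], hk.next.play h, hk.prev.play h,
    hk.safe.mono (play_mono h), by rw [hc, hk.out]⟩

theorem Good.play_ne {F : Board} {n b s j x k} (h : Leg F n b s j x) (hk : Good F n k)
    (hkj : k ≠ j) (hs : ∀ t e, Guarded F n k t e → ¬ (b = true ∧ s = t ∧ j = k + e)) :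
    Good (play F b s j x) n k := by
  rcases hk with hk | hk | ⟨t, e, hk⟩ | ⟨t, hk⟩
  · exact Or.inl ⟨hk.1, fun b' s' => by rw [play_of_ne_col hkj, hk.2]⟩
  · exact Or.inr (Or.inl (hk.play_ne h hkj))
  · exact Or.inr (Or.inr (Or.inl ⟨t, e, hk.play_ne h hkj (hs t e hk)⟩))
  · exact Or.inr (Or.inr (Or.inr ⟨t, hk.play_ne h hkj⟩))

theorem Leg.of_dir {F : Board} {n k : ℤ} {b s : Bool} {x : Fin 4} {e : ℤ} (he : e = 1 ∨ e = -1)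
    (h1 : In n k) (h2 : F b s k = none) (h3 : F b s (k + e) ≠ some x)
    (h4 : F b s (k - e) ≠ some x) (h5 : F (!b) s k ≠ some x)
    (h6 : b = true → F true (!s) k ≠ some x) : Leg F n b s k x := by
  rcases he with rfl | rfl
  · exact ⟨h1, h2, h3, h4, h5, h6⟩
  · exact ⟨h1, h2, by simpa using h4, by simpa [sub_eq_add_neg] using h3, h5, h6⟩

theorem Leg.dir {F : Board} {n k : ℤ} {b s : Bool} {x : Fin 4} (h : Leg F n b s k x) {e : ℤ}
    (he : e = 1 ∨ e = -1) : F b s (k + e) ≠ some x := by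
  rcases he with rfl | rfl
  · exact h.next
  · exact h.prev

theorem dir_neg {e : ℤ} (he : e = 1 ∨ e = -1) : -e = 1 ∨ -e = -1 := by omega

theorem dir_ne {e : ℤ} (he : e = 1 ∨ e = -1) : e ≠ 0 := by omega

theorem Safe.out_cross {F : Board} {s k} (h : Same (F false s k) (F true (!s) k)) : Safe F s k :=
  Or.inr (Or.inl h)

theorem Safe.out_dir {F : Board} {s k} {e : ℤ} (he : e = 1 ∨ e = -1)
    (h : Same (F false s k) (F true s (k + e))) : Safe F s k := by
  rcases he with rfl | rfl
  · exact Or.inr (Or.inr (Or.inl h))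
  · exact Or.inr (Or.inr (Or.inr (Or.inl h)))

theorem Safe.cross_dir {F : Board} {s k} {e : ℤ} (he : e = 1 ∨ e = -1)
    (h : Same (F true (!s) k) (F true s (k + e))) : Safe F s k := by
  rcases he with rfl | rfl
  · exact Or.inr (Or.inr (Or.inr (Or.inr (Or.inl h))))
  · exact Or.inr (Or.inr (Or.inr (Or.inr (Or.inr (Or.inl h)))))

theorem Safe.dir_dir {F : Board} {s k} {e : ℤ} (he : e = 1 ∨ e = -1)
    (h : Same (F true s (k + e)) (F true s (k - e))) : Safe F s k := by
  refine Or.inr (Or.inr (Or.inr (Or.inr (Or.inr (Or.inr ?_)))))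
  rcases he with rfl | rfl
  · exact h
  · have := h.symm
    rwa [sub_neg_eq_add] at this

theorem Enclosed.of_dir {F : Board} {k : ℤ} {s : Bool} {e : ℤ} (he : e = 1 ∨ e = -1)
    (h1 : ∀ t, F true t k = none) (h2 : FullMid F (k + e)) (h3 : FullMid F (k - e))
    (h4 : Safe F s k) (h5 : F false (!s) k = none) : Enclosed F k s := by
  rcases he with rfl | rfl
  · exact ⟨h1, h2, h3, h4, h5⟩
  · exact ⟨h1, by simpa using h3, by simpa [sub_eq_add_neg] using h2, h4, h5⟩

theorem HasMid.of_full {F : Board} {k : ℤ} (h : FullMid F k) : HasMid F k := ⟨true, h true⟩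

theorem not_emp_of_hasMid {F : Board} {n k : ℤ} (h : HasMid F k) : ¬ Emp F n k :=
  fun hE => h.elim fun _ hs => hs (hE.2 _ _)

theorem eq_or_eq_not (s t : Bool) : t = s ∨ t = !s := by cases s <;> cases t <;> simp

theorem Solid.of_half {F : Board} {n k : ℤ} {s : Bool} (h1 : F true s k = none)
    (h2 : F true (!s) k ≠ none) (h3 : Safe F s k)
    (h4 : ∀ e, e = 1 ∨ e = -1 → Emp F n (k + e) →
      (F false (!s) k = none ∨ F false (!s) k = F false s k) ∧
        (F false s k = F true (!s) k ∨ ¬ In n (k - e) ∨ HasMid F (k - e))) : Solid F n k := by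
  constructor
  · exact ⟨_, h2⟩
  · intro t ht
    rcases eq_or_eq_not s t with rfl | rfl
    · exact h3
    · exact absurd ht h2
  · intro h; exact absurd h1 (h s)
  · intro t e he ht
    rcases eq_or_eq_not s t with rfl | rfl
    · exact h4 e he
    · exact absurd ht h2
  · intro e he hE hP
    have := hP (!s)
    rw [Bool.not_not, h1] at this
    exact this.1 this.2

theorem Solid.of_full {F : Board} {n k : ℤ} (h1 : FullMid F k)
    (h2 : Emp F n (k + 1) → Emp F n (k - 1) → Broken F k ∨ ∀ s, F false s k = none)
    (h3 : ∀ e, e = 1 ∨ e = -1 → Emp F n (k + e) → ¬ Perfect F k) : Solid F n k :=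
  ⟨.of_full h1, fun s hs => absurd hs (h1 s), fun _ => h2, fun s _ _ hs => absurd hs (h1 s), h3⟩

theorem Broken.not_perfect {F : Board} {k : ℤ} (h : Broken F k) : ¬ Perfect F k := by
  intro h'
  obtain ⟨s, -, hs⟩ := h
  exact hs _ (h' s).2

/-- Coloring the vertex `(b, s, j)` does not destroy a guarded column. -/
def NoSupport (F : Board) (n : ℤ) (b s : Bool) (j : ℤ) : Prop :=
  ∀ k t e, Guarded F n k t e → ¬ (b = true ∧ s = t ∧ j = k + e)

theorem NoSupport.outer {F : Board} {n : ℤ} {s : Bool} {j : ℤ} : NoSupport F n false s j :=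
  fun _ _ _ _ h => absurd h.1 (by simp)

theorem NoSupport.of_not_hasMid {F : Board} {n : ℤ} {b s : Bool} {j : ℤ} (h : ¬ HasMid F j) :
    NoSupport F n b s j := by
  rintro k t e hk ⟨-, -, rfl⟩
  exact h ⟨_, hk.colored⟩

/-- The column of a support has no empty neighbor: on one side lies the guarded column, whose outer
vertices are colored, on the other the column described by `beyond`. -/
theorem NoSupport.of_emp {F : Board} {n : ℤ} {b s : Bool} {j e : ℤ} (he : e = 1 ∨ e = -1)
    (h : Emp F n (j + e)) : NoSupport F n b s j := by
  rintro k t e' hk ⟨-, -, rfl⟩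
  have hd := hk.dir
  have : e = e' ∨ e = -e' := by omega
  rcases this with rfl | rfl
  · rw [add_assoc, ← two_mul] at h
    rcases hk.beyond with h' | h'
    · exact h' h.1
    · exact not_emp_of_hasMid h' h
  · rw [add_neg_cancel_right] at h
    exact hk.out.1 (h.2 _ _)

theorem Inv.of_reply {F : Board} {n : ℤ} {b s : Bool} {j : ℤ} {x : Fin 4} (hp : Proper F n)
    (hg : ∀ k, In n k → k ≠ j → Good F n k) (h : Leg F n b s j x) (hs : NoSupport F n b s j)
    (hj : Good (play F b s j x) n j) : Inv (play F b s j x) n := by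
  refine ⟨hp.play h, fun k hk => ?_⟩
  by_cases hkj : k = j
  · rwa [hkj]
  · exact (hg k hk hkj).play_ne h hkj (fun t e => hs k t e)

theorem play_col {F : Board} {b s : Bool} {j : ℤ} {x : Fin 4} {k : ℤ} (h : k ≠ j) (b' s' : Bool) :
    play F b s j x b' s' k = F b' s' k := play_of_ne_col h

/-! ### Opening an empty column next to a full one. -/

/-- Alice can open an empty column next to one with colored inner vertices. -/
theorem exists_reply_of_emp {F : Board} {n k e : ℤ} (he : e = 1 ∨ e = -1) (hp : Proper F n)
    (hE : Emp F n k) (hg : ∀ i, In n i → i ≠ k → i ≠ k - e → Good F n i)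
    (hj : ∀ b s x, Leg F n b s k x → Good (play F b s k x) n (k - e))
    (hf : FullMid F (k - e)) (hn : ¬ (Perfect F (k - e) ∧ Perfect F (k + e))) :
    ∃ b s x, Leg F n b s k x ∧ Inv (play F b s k x) n := by
  have e0 := dir_ne he
  have hne : ¬ HasMid F k := fun h => not_emp_of_hasMid h hE
  have key : ∀ b s x, Leg F n b s k x → Good (play F b s k x) n k →
      Inv (play F b s k x) n := by
    intro b s x h hk
    refine ⟨hp.play h, fun i hi => ?_⟩
    by_cases h1 : i = k
    · rwa [h1]
    by_cases h2 : i = k - e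
    · rw [h2]; exact hj _ _ _ h
    exact (hg i hi h1 h2).play_ne h h1 (fun t e => NoSupport.of_not_hasMid hne i t e)
  have hpe : ∀ b s, F b s (k - e) ≠ none → F b s (k - e) = F b s k → False := by
    intro b s h h'; exact h (by rw [h', hE.2])
  -- Repeating the color of `(s, k - e)` diagonally at `(!s, k)` makes the inner vertex on side `s`
  -- safe. This is blocked on both sides only if column `k + e` carries the inner colors of column
  -- `k - e` interchanged.
  by_cases hc : ∃ s, F true (!s) (k + e) ≠ F true s (k - e)
  · obtain ⟨s, hs⟩ := hc
    obtain ⟨x, hx⟩ := Option.ne_none_iff_exists'.1 (hf s)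
    have hl : Leg F n true (!s) k x := by
      refine .of_dir he hE.1 (hE.2 _ _) (hx ▸ hs) ?_ ?_ ?_
      · rw [← hx]; exact (hp.across s _ (hf s)).symm
      · rw [hE.2]; simp
      · rw [hE.2]; simp
    refine ⟨_, _, _, hl, key _ _ _ hl (Or.inr (Or.inl ?_))⟩
    refine Solid.of_half (s := s) ?_ ?_ ?_ ?_
    · rw [play_of_ne (by simp), hE.2]
    · rw [play_self]; simp
    · refine Safe.cross_dir (dir_neg he) ?_
      rw [play_self, play_col (by omega), ← sub_eq_add_neg, hx]
      exact ⟨rfl, by simp⟩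
    · intro e' he' hE'
      refine ⟨Or.inl ?_, Or.inr (Or.inr ?_)⟩
      · rw [play_of_ne (by simp), hE.2]
      · have : e' = e ∨ e' = -e := by omega
        rcases this with rfl | rfl
        · exact (HasMid.of_full hf).play hl
        · exact absurd hE'.of_play.1 (not_emp_of_hasMid (by
            rw [← sub_eq_add_neg]; exact .of_full hf))
  · push Not at hc
    have hf' : FullMid F (k + e) := by
      intro s
      have := hc (!s)
      rw [Bool.not_not] at this
      rw [this]; exact hf _
    have fin : ∀ s x, Leg F n false s k x → Safe (play F false s k x) s k →
        ∃ b s x, Leg F n b s k x ∧ Inv (play F b s k x) n := by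
      intro s x hl hs
      refine ⟨_, _, _, hl, key _ _ _ hl (Or.inr (Or.inr (Or.inr ⟨s, ?_⟩)))⟩
      refine .of_dir he (fun t => ?_) (hf'.play hl) (hf.play hl) hs ?_
      · rw [play_of_ne (by simp), hE.2]
      · rw [play_of_ne (by simp), hE.2]
    -- Both neighbors are now full, so one outer move that makes its inner neighbor safe would
    -- enclose column `k`. On each side two colors would do this; all of them are illegal only if
    -- both neighbors are perfect.
    by_contra hcon
    apply hn
    constructor
    · intro s
      obtain ⟨x, hx⟩ := Option.ne_none_iff_exists'.1 (hf (!s))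
      rw [hx]
      by_contra hne'
      have hne2 : F false s (k - e) ≠ some x := by
        intro h; rw [h] at hne'; simp at hne'
      have h1 := hc (!s)
      rw [Bool.not_not, hx] at h1
      have hl : Leg F n false s k x := by
        refine .of_dir he hE.1 (hE.2 _ _) ?_ hne2 ?_ (by simp)
        · rw [← h1]; exact (hp.cross true s _ (hf' s)).symm
        · rw [hE.2]; simp
      refine hcon (fin s x hl (Safe.out_dir he ?_))
      rw [play_self, play_col (by omega), h1]
      exact ⟨rfl, by simp⟩
    · intro s
      obtain ⟨x, hx⟩ := Option.ne_none_iff_exists'.1 (hf s)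
      rw [hc s, hx]
      by_contra hne'
      have hne2 : F false s (k + e) ≠ some x := by
        intro h; rw [h] at hne'; simp at hne'
      have hl : Leg F n false s k x := by
        refine .of_dir he hE.1 (hE.2 _ _) hne2 ?_ ?_ (by simp)
        · rw [← hx]; exact (hp.cross true s _ (hf s)).symm
        · rw [hE.2]; simp
      refine hcon (fin s x hl (Safe.out_dir (dir_neg he) ?_))
      rw [play_self, play_col (by omega), ← sub_eq_add_neg, hx]
      exact ⟨rfl, by simp⟩

/-! ### Every uncolored vertex remains colorable under the invariant. -/

theorem exists_color_of_same {u v : Option (Fin 4)} (w z : Option (Fin 4)) (h : Same u v) :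
    ∃ x : Fin 4, u ≠ some x ∧ v ≠ some x ∧ w ≠ some x ∧ z ≠ some x := by
  obtain ⟨x, h1, h2, h3⟩ := exists_color u w z
  exact ⟨x, h1, h.1 ▸ h1, h2, h3⟩

theorem Safe.exists_leg {F : Board} {n k : ℤ} {s : Bool} (hs : Safe F s k) (hp : Proper F n)
    (hk : In n k) (h : F true s k = none) : ∃ x, Leg F n true s k x := by
  suffices ∃ x, F true s (k + 1) ≠ some x ∧ F true s (k - 1) ≠ some x ∧
      F false s k ≠ some x ∧ F true (!s) k ≠ some x by
    obtain ⟨x, h1, h2, h3, h4⟩ := this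
    exact ⟨x, hk, h, h1, h2, h3, fun _ => h4⟩
  rcases hs with hs | hs | hs | hs | hs | hs | hs
  · obtain ⟨x, h1, h2, h3⟩ := exists_color (F true s (k + 1)) (F false s k) (F true (!s) k)
    refine ⟨x, h1, ?_, h2, h3⟩
    rw [hp.outside _ _ _ (by rw [hs]; simp [In])]; simp
  · obtain ⟨x, h1, h2, h3, h4⟩ := exists_color_of_same (F true s (k + 1)) (F true s (k - 1)) hs
    exact ⟨x, h3, h4, h1, h2⟩
  · obtain ⟨x, h1, h2, h3, h4⟩ := exists_color_of_same (F true s (k - 1)) (F true (!s) k) hs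
    exact ⟨x, h2, h3, h1, h4⟩
  · obtain ⟨x, h1, h2, h3, h4⟩ := exists_color_of_same (F true s (k + 1)) (F true (!s) k) hs
    exact ⟨x, h3, h2, h1, h4⟩
  · obtain ⟨x, h1, h2, h3, h4⟩ := exists_color_of_same (F true s (k - 1)) (F false s k) hs
    exact ⟨x, h2, h3, h4, h1⟩
  · obtain ⟨x, h1, h2, h3, h4⟩ := exists_color_of_same (F true s (k + 1)) (F false s k) hs
    exact ⟨x, h3, h2, h4, h1⟩
  · obtain ⟨x, h1, h2, h3, h4⟩ := exists_color_of_same (F false s k) (F true (!s) k) hs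
    exact ⟨x, h1, h2, h3, h4⟩

theorem Guarded.exists_leg {F : Board} {n k e : ℤ} {s : Bool} (h : Guarded F n k s e)
    (hk : In n k) : ∃ x, Leg F n true s k x := by
  obtain ⟨x, h1, h2, -⟩ := exists_color (F true s (k - e)) (F false s k) none
  refine ⟨x, .of_dir h.dir hk (h.mid _) ?_ h1 h2 ?_⟩
  · rw [h.support]; simp
  · rw [h.mid]; simp

theorem Enclosed.exists_leg {F : Board} {n k : ℤ} {s : Bool} (h : Enclosed F k s) (hk : In n k) :
    ∃ x, Leg F n true (!s) k x := by
  obtain ⟨x, h1, h2, -⟩ := exists_color (F true (!s) (k + 1)) (F true (!s) (k - 1)) none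
  refine ⟨x, hk, h.mid _, h1, h2, ?_, ?_⟩
  · rw [Bool.not_true, h.out]; simp
  · rw [h.mid]; simp

theorem exists_leg_outer {F : Board} {n k : ℤ} {s : Bool} (hk : In n k) (h : F false s k = none) :
    ∃ x, Leg F n false s k x := by
  obtain ⟨x, h1, h2, h3⟩ := exists_color (F false s (k + 1)) (F false s (k - 1)) (F true s k)
  exact ⟨x, hk, h, h1, h2, h3, by simp⟩

/-- Under the invariant every uncolored vertex can be colored. -/
theorem Inv.exists_leg {F : Board} {n k : ℤ} {b s : Bool} (hF : Inv F n) (hk : In n k)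
    (h : F b s k = none) : ∃ x, Leg F n b s k x := by
  cases b with
  | false => exact exists_leg_outer hk h
  | true =>
    rcases hF.good k hk with hE | hS | ⟨t, e, hG⟩ | ⟨t, hQ⟩
    · obtain ⟨x, h1, h2, -⟩ := exists_color (F true s (k + 1)) (F true s (k - 1)) none
      refine ⟨x, hk, h, h1, h2, ?_, ?_⟩ <;> rw [hE.2] <;> simp
    · exact (hS.safe s h).exists_leg hF.proper hk h
    · rcases eq_or_eq_not t s with rfl | rfl
      · exact hG.exists_leg hk
      · exact hG.safe.exists_leg hF.proper hk h
    · rcases eq_or_eq_not t s with rfl | rfl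
      · exact hQ.safe.exists_leg hF.proper hk h
      · exact hQ.exists_leg hk

theorem Guarded.mem {F : Board} {n k e : ℤ} {s : Bool} (h : Guarded F n k s e)
    (hp : Proper F n) : In n k := by
  by_contra hk
  exact h.out.1 (hp.outside _ _ _ hk)

theorem FullMid.mem {F : Board} {n k : ℤ} (h : FullMid F k) (hp : Proper F n) : In n k := by
  by_contra hk
  exact h true (hp.outside _ _ _ hk)

theorem Enclosed.mem {F : Board} {n k : ℤ} {s : Bool} (h : Enclosed F k s)
    (hp : Proper F n) : In n k := by
  have h1 := h.next.mem hp
  have h2 := h.prev.mem hp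
  unfold In at *; omega

theorem solid_of_weak {F : Board} {n k e : ℤ} {s : Bool} {x : Fin 4} (he : e = 1 ∨ e = -1)
    (hm : ∀ t, F true t k = none) (ho : F false true k = F false false k) (hs : Safe F (!s) k)
    (hc : HasMid F (k + e)) (hl : Leg F n true s k x) : Solid (play F true s k x) n k := by
  refine Solid.of_half (s := !s) ?_ ?_ (hs.mono (play_mono hl)) ?_
  · rw [play_of_ne (by simp), hm]
  · rw [Bool.not_not, play_self]; simp
  · intro e' he' hE
    refine ⟨Or.inr ?_, Or.inr (Or.inr ?_)⟩
    · rw [play_of_ne (by simp), play_of_ne (by simp)]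
      cases s <;> simp [ho]
    · have : e' = -e := by
        have : e' = e ∨ e' = -e := by omega
        rcases this with rfl | rfl
        · exact absurd hE.of_play.1 (not_emp_of_hasMid hc)
        · rfl
      rw [this, sub_neg_eq_add]
      exact hc.play hl

/-- Coloring the endangered vertex of a guarded column makes the column solid. -/
theorem Guarded.solid_of_weak {F : Board} {n k e : ℤ} {s : Bool} {x : Fin 4}
    (h : Guarded F n k s e) (hl : Leg F n true s k x) : Solid (play F true s k x) n k :=
  GridGame.solid_of_weak h.dir h.mid h.out.2 h.safe ⟨_, h.colored⟩ hl

theorem Solid.colored {F : Board} {n k : ℤ} {s : Bool} (hS : Solid F n k)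
    (h0 : F true s k = none) : F true (!s) k ≠ none := by
  obtain ⟨t, ht⟩ := hS.hasMid
  rcases eq_or_eq_not s t with rfl | rfl
  · exact absurd h0 ht
  · exact ht

theorem Solid.fullMid_play {F : Board} {n k : ℤ} {s : Bool} {x : Fin 4} (hS : Solid F n k)
    (hl : Leg F n true s k x) : FullMid (play F true s k x) k := by
  intro t
  rcases eq_or_eq_not s t with rfl | rfl
  · rw [play_self]; simp
  · have := hS.colored hl.free
    rwa [play_mono hl _ _ _ this]

/-- This is what the first part of `half` is for: the outer vertex opposite to the missing inner one
is uncolored or repeats the other outer color, and neither occurs in an alternating column. -/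
theorem Solid.not_perfect_play {F : Board} {n k e : ℤ} {s : Bool} {x : Fin 4} (hp : Proper F n)
    (hS : Solid F n k) (hl : Leg F n true s k x) (he : e = 1 ∨ e = -1) (hE : Emp F n (k + e)) :
    ¬ Perfect (play F true s k x) k := by
  intro hP
  have h1 := (hS.half s e he hl.free hE).1
  have h2 := hP s
  have h3 := hP (!s)
  rw [Bool.not_not, play_self, play_of_ne (by simp)] at h3
  rw [play_of_ne (by simp)] at h2
  rcases h1 with h1 | h1
  · exact h3.1 h1
  · have := (hp.play hl).across s k (by rw [play_self]; simp)
    rw [play_self, ← h3.2, h1] at this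
    exact this h2.2

/-- Coloring the endangered vertex of an enclosed column makes the column solid. -/
theorem Enclosed.solid_of_weak {F : Board} {n k : ℤ} {s : Bool} {x : Fin 4}
    (h : Enclosed F k s) (hl : Leg F n true (!s) k x) : Solid (play F true (!s) k x) n k := by
  refine Solid.of_half (s := s) ?_ ?_ (h.safe.mono (play_mono hl)) ?_
  · rw [play_of_ne (by simp), h.mid]
  · rw [play_self]; simp
  · intro e' he' hE
    rcases he' with rfl | rfl
    · exact absurd hE.of_play.1 (not_emp_of_hasMid (.of_full h.next))
    · exact absurd hE.of_play.1 (not_emp_of_hasMid (.of_full h.prev))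

/-! ### Alice's extra move. -/

theorem exists_boundary {n : ℤ} {p : ℤ → Prop} {a b : ℤ} (ha : In n a) (hb : In n b) (hpa : p a)
    (hpb : ¬ p b) : ∃ k e, (e = 1 ∨ e = -1) ∧ In n k ∧ In n (k - e) ∧ p k ∧ ¬ p (k - e) := by
  by_contra hcon
  push Not at hcon
  have h1 : ∀ m : ℕ, In n (a + m) → p (a + m) := by
    intro m
    induction m with
    | zero => intro _; simpa using hpa
    | succ m ih =>
      intro h
      have h' : In n (a + m) := by unfold In at *; push_cast at h; omega
      have := hcon (a + m) (-1) (Or.inr rfl) h' (by push_cast at h; convert h using 1; ring) (ih h')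
      push_cast; convert this using 1; ring
  have h2 : ∀ m : ℕ, In n (a - m) → p (a - m) := by
    intro m
    induction m with
    | zero => intro _; simpa using hpa
    | succ m ih =>
      intro h
      have h' : In n (a - m) := by unfold In at *; push_cast at h; omega
      have := hcon (a - m) 1 (Or.inl rfl) h' (by push_cast at h; convert h using 1; ring) (ih h')
      push_cast; convert this using 1; ring
  rcases le_total a b with h | h
  · have := h1 (b - a).toNat (by rw [Int.toNat_of_nonneg (by omega)]; simpa using hb)
    rw [Int.toNat_of_nonneg (by omega)] at this
    simp only [add_sub_cancel] at this
    exact hpb this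
  · have := h2 (a - b).toNat (by rw [Int.toNat_of_nonneg (by omega)]; simpa using hb)
    rw [Int.toNat_of_nonneg (by omega)] at this
    simp only [sub_sub_cancel] at this
    exact hpb this

theorem exists_least {n : ℤ} {p : ℤ → Prop} (hp : ∀ k, p k → In n k) {a : ℤ} (ha : p a) :
    ∃ k, p k ∧ ∀ i, p i → k ≤ i := by
  obtain ⟨k, h1, h2⟩ := Int.exists_least_of_bdd (P := p) ⟨0, fun z hz => (hp z hz).1⟩ ⟨a, ha⟩
  exact ⟨k, h1, h2⟩

/-- Alice can open an empty column to the left of a half colored one with two empty neighbors,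
unless the column further to the left has an uncolored inner vertex as well. -/
theorem exists_reply_of_half {F : Board} {n k : ℤ} {s : Bool} (hp : Proper F n)
    (hg : ∀ i, In n i → Good F n i) (hS : Solid F n k) (h0 : F true s k = none)
    (h2 : Emp F n (k - 1)) (h3 : HasMid F (k - 2) → FullMid F (k - 2)) :
    ∃ b s i x, Leg F n b s i x ∧ Inv (play F b s i x) n := by
  have hk : F true (!s) k ≠ none := hS.colored h0
  have hkm : HasMid F k := ⟨_, hk⟩
  have hm : ¬ HasMid F (k - 1) := fun h => not_emp_of_hasMid h h2
  have key : ∀ x, Leg F n true s (k - 1) x → Safe (play F true s (k - 1) x) (!s) (k - 1) →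
      ∃ b s i x, Leg F n b s i x ∧ Inv (play F b s i x) n := by
    intro x hl hs
    refine ⟨_, _, _, _, hl, .of_reply hp (fun i hi _ => hg i hi) hl (.of_not_hasMid hm)
      (Or.inr (Or.inl ?_))⟩
    refine Solid.of_half (s := !s) ?_ ?_ hs ?_
    · rw [play_of_ne (by simp), h2.2]
    · rw [Bool.not_not, play_self]; simp
    · intro e he hE
      rcases he with rfl | rfl
      · rw [sub_add_cancel] at hE
        exact absurd hE.of_play.1 (not_emp_of_hasMid hkm)
      · refine ⟨Or.inl ?_, Or.inr (Or.inr ?_)⟩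
        · rw [play_of_ne (by simp), h2.2]
        · rw [sub_neg_eq_add, sub_add_cancel]; exact hkm.play hl
  have hleg : ∀ x, F true s (k - 2) ≠ some x → Leg F n true s (k - 1) x := by
    intro x hx
    refine ⟨h2.1, h2.2 _ _, ?_, ?_, ?_, ?_⟩
    · rw [sub_add_cancel, h0]; simp
    · rwa [sub_sub]
    · rw [h2.2]; simp
    · rw [h2.2]; simp
  obtain ⟨x, hx⟩ := Option.ne_none_iff_exists'.1 hk
  -- The color of the inner vertex `(!s, k)` is repeated diagonally at `(s, k - 1)`. If `(s, k - 2)`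
  -- forbids it, that column is full and the color of `(!s, k - 2)` serves instead.
  by_cases hc : F true s (k - 2) = some x
  · have hf := h3 ⟨s, by simp [hc]⟩
    obtain ⟨y, hy⟩ := Option.ne_none_iff_exists'.1 (hf (!s))
    refine key y (hleg y ?_) (Safe.cross_dir (e := -1) (Or.inr rfl) ?_)
    · rw [← hy]; exact hp.across _ _ (hf s)
    · rw [Bool.not_not, play_self, play_col (by omega), show k - 1 + -1 = k - 2 by ring, hy]
      exact ⟨rfl, by simp⟩
  · refine key x (hleg x hc) (Safe.cross_dir (e := 1) (Or.inl rfl) ?_)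
    rw [Bool.not_not, play_self, sub_add_cancel, play_col (by omega), hx]
    exact ⟨rfl, by simp⟩

/-- Under the invariant Alice can make an extra move. -/
theorem Inv.exists_move {F : Board} {n : ℤ} (hF : Inv F n)
    (hne : ∃ b s k, In n k ∧ F b s k = none) :
    ∃ b s k x, Leg F n b s k x ∧ Inv (play F b s k x) n := by
  have hp := hF.proper
  have hg : ∀ j, ∀ k, In n k → k ≠ j → Good F n k := fun _ k hk _ => hF.good k hk
  by_cases c1 : ∃ k t e, Guarded F n k t e
  · obtain ⟨k, t, e, hG⟩ := c1
    obtain ⟨x, hl⟩ := hG.exists_leg (hG.mem hp)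
    refine ⟨_, _, _, _, hl, .of_reply hp (hg k) hl (.of_not_hasMid ?_)
      (Or.inr (Or.inl (hG.solid_of_weak hl)))⟩
    rintro ⟨s, hs⟩; exact hs (hG.mid s)
  have hns : ∀ b s j, NoSupport F n b s j := fun b s j k t e h => absurd ⟨k, t, e, h⟩ c1
  by_cases c2 : ∃ k t, Enclosed F k t
  · obtain ⟨k, t, hQ⟩ := c2
    obtain ⟨x, hl⟩ := hQ.exists_leg (hQ.mem hp)
    exact ⟨_, _, _, _, hl, .of_reply hp (hg k) hl (hns _ _ _)
      (Or.inr (Or.inl (hQ.solid_of_weak hl)))⟩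
  have hES : ∀ k, In n k → Emp F n k ∨ Solid F n k := by
    intro k hk
    rcases hF.good k hk with h | h | ⟨t, e, h⟩ | ⟨t, h⟩
    · exact Or.inl h
    · exact Or.inr h
    · exact absurd ⟨k, t, e, h⟩ c1
    · exact absurd ⟨k, t, h⟩ c2
  by_cases c3 : ∃ k s, In n k ∧ Solid F n k ∧ FullMid F k ∧ F false s k = none
  · obtain ⟨k, s, hk, hS, hf, h0⟩ := c3
    by_cases hE : ∃ e, (e = 1 ∨ e = -1) ∧ Emp F n (k + e)
    · obtain ⟨e, he, hE⟩ := hE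
      -- The empty column on one side leaves enough freedom for a color foreign to both inner
      -- vertices, which breaks the column.
      obtain ⟨x, h1, h2, h3⟩ := exists_color (F false s (k - e)) (F true s k) (F true (!s) k)
      have hl : Leg F n false s k x := by
        refine .of_dir he hk h0 ?_ h1 h2 (by simp)
        rw [hE.2]; simp
      have hB : Broken (play F false s k x) k := by
        refine ⟨s, by rw [play_self]; simp, fun t => ?_⟩
        rw [play_self, play_of_ne (by simp)]
        rcases eq_or_eq_not s t with rfl | rfl
        · exact h2.symm
        · exact h3.symm
      refine ⟨_, _, _, _, hl, .of_reply hp (hg k) hl (hns _ _ _) (Or.inr (Or.inl ?_))⟩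
      exact .of_full (hf.play hl) (fun _ _ => Or.inl hB) (fun _ _ _ => hB.not_perfect)
    · push Not at hE
      obtain ⟨x, hl⟩ := exists_leg_outer hk h0
      refine ⟨_, _, _, _, hl, .of_reply hp (hg k) hl (hns _ _ _) (Or.inr (Or.inl ?_))⟩
      exact .of_full (hf.play hl) (fun h => absurd h.of_play.1 (hE 1 (Or.inl rfl)))
        (fun e he h => absurd h.of_play.1 (hE e he))
  by_cases c4 : ∃ k s, In n k ∧ Solid F n k ∧ F true s k = none ∧
      ¬ (Emp F n (k + 1) ∧ Emp F n (k - 1))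
  · obtain ⟨k, s, hk, hS, h0, hn⟩ := c4
    obtain ⟨x, hl⟩ := (hS.safe s h0).exists_leg hp hk h0
    refine ⟨_, _, _, _, hl, .of_reply hp (hg k) hl (hns _ _ _) (Or.inr (Or.inl ?_))⟩
    exact .of_full (hS.fullMid_play hl) (fun h1 h2 => absurd ⟨h1.of_play.1, h2.of_play.1⟩ hn)
      (fun e he hE => hS.not_perfect_play hp hl he hE.of_play.1)
  by_cases c5 : ∃ k, In n k ∧ Solid F n k ∧ ∃ s, F true s k = none
  · obtain ⟨k0, hk0⟩ := c5
    -- Taking the leftmost half colored column ensures that column `k - 2` is full if any inner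
    -- vertex of it is colored.
    obtain ⟨k, ⟨hk, hS, s, h0⟩, hmin⟩ := exists_least (n := n)
      (p := fun k => In n k ∧ Solid F n k ∧ ∃ s, F true s k = none) (fun _ h => h.1) hk0
    have hE : Emp F n (k + 1) ∧ Emp F n (k - 1) := by
      by_contra h
      exact c4 ⟨k, s, hk, hS, h0, h⟩
    refine exists_reply_of_half hp hF.good hS h0 hE.2 ?_
    intro hm t ht
    have hk2 : In n (k - 2) := by
      by_contra hk2
      obtain ⟨u, hu⟩ := hm
      exact hu (hp.outside _ _ _ hk2)
    rcases hES _ hk2 with h | h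
    · exact not_emp_of_hasMid hm h
    · have := hmin _ ⟨hk2, h, t, ht⟩
      omega
  have hfull : ∀ k, In n k → ¬ Emp F n k → FullMid F k := by
    intro k hk hE t ht
    rcases hES k hk with h | h
    · exact hE h
    · exact c5 ⟨k, hk, h, t, ht⟩
  obtain ⟨b, s, k, hk, h0⟩ := hne
  have hEk : Emp F n k := by
    by_contra hE
    have hf := hfull k hk hE
    cases b with
    | true => exact hf s h0
    | false => exact c3 ⟨k, s, hk, (hES k hk).resolve_left hE, hf, h0⟩
  by_cases c6 : ∃ j, In n j ∧ ¬ Emp F n j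
  · obtain ⟨j, hj, hjE⟩ := c6
    obtain ⟨i, e, he, hi, hie, hE, hnE⟩ := exists_boundary (p := Emp F n) hk hj hEk hjE
    obtain ⟨b, s, x, h⟩ := exists_reply_of_emp he hp hE (fun i hi _ _ => hF.good i hi)
      (fun b s x hl => Or.inr (Or.inl (((hES _ hie).resolve_left hnE).play_ne hl
        (by have := dir_ne he; omega)))) (hfull _ hie hnE)
      (fun h => ((hES _ hie).resolve_left hnE).perfect e he (by rwa [sub_add_cancel]) h.1)
    exact ⟨b, s, i, x, h⟩
  · push Not at c6
    have h00 : In n 0 := by unfold In at *; omega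
    have hE0 := c6 0 h00
    have hnone : ∀ b s k, F b s k = none := by
      intro b s k
      by_cases hk : In n k
      · exact (c6 k hk).2 b s
      · exact hp.outside _ _ _ hk
    -- On the empty board Alice starts in the end column, where the other inner vertex is safe for
    -- lack of a left neighbor.
    have hl : Leg F n true true 0 0 := by
      refine ⟨h00, hnone _ _ _, ?_, ?_, ?_, ?_⟩ <;> rw [hnone] <;> simp
    refine ⟨_, _, _, _, hl, .of_reply hp (hg 0) hl (hns _ _ _) (Or.inr (Or.inl ?_))⟩
    refine Solid.of_half (s := false) ?_ ?_ (Or.inl rfl) ?_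
    · rw [play_of_ne (by simp), hnone]
    · simp [play]
    · intro e he hE
      refine ⟨Or.inl ?_, Or.inr (Or.inl ?_)⟩
      · rw [play_of_ne (by simp), hnone]
      · have := hE.1; unfold In at *; omega

/-! ### Alice's answers to Bob, by the type of the column he plays in. -/

/-- After a move of Bob and a reply of Alice only the two columns concerned have to be checked. -/
theorem Inv.of_two {F : Board} {n : ℤ} {b s : Bool} {j : ℤ} {x : Fin 4} {b' s' : Bool} {i : ℤ}
    {y : Fin 4} (hF : Inv F n) (h1 : Leg F n b s j x) (h2 : Leg (play F b s j x) n b' s' i y)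
    (ns1 : ∀ k t e, k ≠ i → Guarded F n k t e → ¬ (b = true ∧ s = t ∧ j = k + e))
    (ns2 : NoSupport F n b' s' i) (hj : Good (play (play F b s j x) b' s' i y) n j)
    (hi : Good (play (play F b s j x) b' s' i y) n i) :
    Inv (play (play F b s j x) b' s' i y) n := by
  refine ⟨(hF.proper.play h1).play h2, fun k hk => ?_⟩
  by_cases e1 : k = j
  · rwa [e1]
  by_cases e2 : k = i
  · rwa [e2]
  rcases hF.good k hk with hk | hk | ⟨t, e, hk⟩ | ⟨t, hk⟩
  · exact Or.inl ⟨hk.1, fun b' s' => by rw [play_col e2, play_col e1, hk.2]⟩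
  · exact Or.inr (Or.inl ((hk.play_ne h1 e1).play_ne h2 e2))
  · exact Or.inr (Or.inr (Or.inl ⟨t, e, (hk.play_ne h1 e1 (ns1 k t e e2 hk)).play_ne h2 e2
      (ns2 k t e hk)⟩))
  · exact Or.inr (Or.inr (Or.inr ⟨t, (hk.play_ne h1 e1).play_ne h2 e2⟩))

/-- Alice has a move that restores the invariant. -/
def Answer (F : Board) (n : ℤ) : Prop := ∃ b s k x, Leg F n b s k x ∧ Inv (play F b s k x) n

theorem Inv.answer_col {F : Board} {n : ℤ} {b s : Bool} {j : ℤ} {x : Fin 4} {b' s' : Bool}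
    {y : Fin 4} (hF : Inv F n) (h1 : Leg F n b s j x) (h2 : Leg (play F b s j x) n b' s' j y)
    (ns1 : NoSupport F n b s j) (ns2 : NoSupport F n b' s' j)
    (hj : Good (play (play F b s j x) b' s' j y) n j) : Answer (play F b s j x) n :=
  ⟨_, _, _, _, h2, hF.of_two h1 h2 (fun k t e _ => ns1 k t e) ns2 hj hj⟩

theorem Inv.answer_free {F : Board} {n : ℤ} {b s : Bool} {j : ℤ} {x : Fin 4}
    (hF : Inv F n) (h1 : Leg F n b s j x) (ns : NoSupport F n b s j)
    (hj : Good (play F b s j x) n j)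
    (hne : ∃ b' s' k, In n k ∧ play F b s j x b' s' k = none) : Answer (play F b s j x) n :=
  (Inv.of_reply hF.proper (fun k hk _ => hF.good k hk) h1 ns hj).exists_move hne

theorem Inv.answer_emp_inner {F : Board} {n : ℤ} {s : Bool} {j : ℤ} {x : Fin 4}
    (hF : Inv F n) (h1 : Leg F n true s j x) (hE : Emp F n j) : Answer (play F true s j x) n := by
  have hm : ¬ HasMid F j := fun h => not_emp_of_hasMid h hE
  obtain ⟨y, c1, c2, c3⟩ := exists_color (some x) (F true (!s) (j + 1)) (F true (!s) (j - 1))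
  have h2 : Leg (play F true s j x) n true (!s) j y := by
    refine ⟨hE.1, ?_, ?_, ?_, ?_, ?_⟩
    · rw [play_of_ne (by simp), hE.2]
    · rwa [play_col (by omega)]
    · rwa [play_col (by omega)]
    · rw [play_of_ne (by simp), hE.2]; simp
    · rwa [Bool.not_not, play_self, imp_iff_right rfl]
  refine hF.answer_col h1 h2 (.of_not_hasMid hm) (.of_not_hasMid hm) (Or.inr (Or.inl ?_))
  have ho : ∀ t, play (play F true s j x) true (!s) j y false t j = none := by
    intro t
    rw [play_of_ne (by simp), play_of_ne (by simp), hE.2]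
  refine .of_full (fun t => ?_) (fun _ _ => Or.inr ho) (fun e _ _ h => (h true).1 (ho _))
  rcases eq_or_eq_not s t with rfl | rfl
  · rw [play_of_ne (by simp), play_self]; simp
  · rw [play_self]; simp

theorem Inv.solid_of_hasMid {F : Board} {n k : ℤ} (hF : Inv F n) (h : HasMid F k) :
    Solid F n k := by
  have hk : In n k := by
    by_contra hk
    obtain ⟨s, hs⟩ := h
    exact hs (hF.proper.outside _ _ _ hk)
  obtain ⟨u, hu⟩ := h
  rcases hF.good k hk with h | h | ⟨t, e, h⟩ | ⟨t, h⟩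
  · exact absurd (h.2 _ _) hu
  · exact h
  · exact absurd (h.mid _) hu
  · exact absurd (h.mid _) hu

/-- The main case analysis. Alice tries to color one inner vertex of the column so that the other
becomes safe; where this fails, the neighboring colors are so constrained that she can make the
column guarded or enclosed instead. -/
theorem Inv.answer_emp_outer {F : Board} {n : ℤ} {s : Bool} {j : ℤ} {x : Fin 4}
    (hF : Inv F n) (h1 : Leg F n false s j x) (hE : Emp F n j) :
    Answer (play F false s j x) n := by
  have hp := hF.proper
  have hm : ¬ HasMid F j := fun h => not_emp_of_hasMid h hE
  have hxs : play F false s j x false s j = some x := play_self ..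
  have hmid : ∀ t, play F false s j x true t j = none := fun t => by
    rw [play_of_ne (by simp), hE.2]
  have hod : play F false s j x false (!s) j = none := by rw [play_of_ne (by simp), hE.2]
  have hleg : ∀ t y e, e = 1 ∨ e = -1 → F true t (j + e) ≠ some y → F true t (j - e) ≠ some y →
      (t = s → x ≠ y) → Leg (play F false s j x) n true t j y := by
    intro t y e he c1 c2 c3
    have e0 := dir_ne he
    refine .of_dir he hE.1 (hmid t) ?_ ?_ ?_ ?_
    · rwa [play_col (by omega)]
    · rwa [play_col (by omega)]
    · rcases eq_or_eq_not s t with rfl | rfl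
      · rw [Bool.not_true, hxs]; simpa using c3 rfl
      · rw [Bool.not_true, hod]; simp
    · rw [hmid]; simp
  have hhalf : ∀ t u y, u = !t → Leg (play F false s j x) n true u j y →
      Safe (play (play F false s j x) true u j y) t j →
      (∀ e, e = 1 ∨ e = -1 → Emp F n (j + e) →
        t = s ∧ (some x = some y ∨ HasMid F (j - e))) → Answer (play F false s j x) n := by
    rintro t u y rfl h2 hs h4
    refine hF.answer_col h1 h2 .outer (.of_not_hasMid hm) (Or.inr (Or.inl ?_))
    refine Solid.of_half (s := t) ?_ ?_ hs ?_
    · rw [play_of_ne (by simp), hmid]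
    · rw [play_self]; simp
    · intro e he hE'
      obtain ⟨rfl, h5⟩ := h4 e he hE'.of_play.1.of_play.1
      refine ⟨Or.inl ?_, ?_⟩
      · rw [play_of_ne (by simp), hod]
      · rw [play_self, play_of_ne (by simp), hxs]
        exact h5.imp id fun h => Or.inr ((h.play h1).play h2)
  -- The ideal reply repeats `x` at the diagonally opposite inner vertex. From here on `e` points
  -- away from a column whose inner vertex on side `!s` forbids that.
  by_cases hA : F true (!s) (j + 1) ≠ some x ∧ F true (!s) (j - 1) ≠ some x
  · refine hhalf s _ x rfl (hleg _ x 1 (Or.inl rfl) hA.1 hA.2 (by simp)) (.out_cross ?_)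
      fun e _ _ => ⟨rfl, Or.inl rfl⟩
    rw [play_self, play_of_ne (by simp), hxs]
    exact ⟨rfl, by simp⟩
  obtain ⟨e, he, hl⟩ : ∃ e, (e = 1 ∨ e = -1) ∧ F true (!s) (j - e) = some x := by
    rw [not_and_or, not_not, not_not] at hA
    rcases hA with hA | hA
    · exact ⟨-1, Or.inr rfl, by rwa [sub_neg_eq_add]⟩
    · exact ⟨1, Or.inl rfl, hA⟩
  have e0 := dir_ne he
  have hle : HasMid F (j - e) := ⟨!s, by simp [hl]⟩
  have hdir : ∀ e', e' = 1 ∨ e' = -1 → Emp F n (j + e') → e' = e := by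
    intro e' he' h
    have : e' = e ∨ e' = -e := by omega
    rcases this with rfl | rfl
    · rfl
    · exact absurd h (not_emp_of_hasMid hle)
  have hvac : HasMid F (j + e) → ∀ y t e', e' = 1 ∨ e' = -1 → Emp F n (j + e') →
      t = s ∧ (some x = some y ∨ HasMid F (j - e')) := by
    intro hr y t e' he' h
    obtain rfl := hdir e' he' h
    exact absurd h (not_emp_of_hasMid hr)
  by_cases hq : F true s (j + e) = none
  swap
  · have hr : HasMid F (j + e) := ⟨_, hq⟩
    obtain ⟨q, hq⟩ := Option.ne_none_iff_exists'.1 hq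
    by_cases hqx : q = x
    · subst hqx
      obtain ⟨y, c1, c2, -⟩ := exists_color (F true (!s) (j + e)) (F true (!s) (j - e)) none
      refine hhalf s _ y rfl (hleg _ y e he c1 c2 (by simp)) (.out_dir he ?_) (hvac hr _ _)
      rw [play_of_ne (by simp), hxs, play_col (by omega), play_col (by omega), hq]
      exact ⟨rfl, by simp⟩
    · have c1 : F true (!s) (j + e) ≠ some q := by
        rw [← hq]; exact (hp.across s _ (by simp [hq])).symm
      refine hhalf s _ q rfl (hleg _ q e he c1 (by simpa [hl] using Ne.symm hqx) (by simp))
        (.cross_dir he ?_) (hvac hr _ _)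
      rw [play_self, play_col (by omega), play_col (by omega), hq]
      exact ⟨rfl, by simp⟩
  by_cases hrx : F true (!s) (j + e) = some x
  · have hr : HasMid F (j + e) := ⟨!s, by simp [hrx]⟩
    obtain ⟨y, c1, c2, c3⟩ := exists_color (F true s (j + e)) (F true s (j - e)) (some x)
    refine hhalf (!s) s y (by simp) (hleg _ y e he c1 c2 (fun _ => by simpa using c3))
      (.dir_dir he ?_) (hvac hr _ _)
    rw [play_col (by omega), play_col (by omega), play_col (by omega), play_col (by omega), hrx, hl]
    exact ⟨rfl, by simp⟩
  -- Replying `x` at the other outer vertex makes side `!s` safe, by the `x` in column `j - e`, and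
  -- side `s` guarded by a support in column `j + e'`.
  have houter : F false (!s) (j + e) ≠ some x → ∀ e', e' = 1 ∨ e' = -1 →
      F true s (j + e') = none → F true (!s) (j + e') ≠ none →
      (¬ In n (j + 2 * e') ∨ HasMid F (j + 2 * e')) → Answer (play F false s j x) n := by
    intro hd e' he' hs hs' hb
    have h2 : Leg (play F false s j x) n false (!s) j x := by
      refine .of_dir he hE.1 hod ?_ ?_ ?_ (by simp)
      · rwa [play_col (by omega)]
      · rw [play_col (by omega), ← hl]
        exact (hp.cross true _ _ (by simp [hl])).symm
      · rw [Bool.not_false, hmid]; simp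
    refine hF.answer_col h1 h2 .outer .outer (Or.inr (Or.inr (Or.inl ⟨s, e', ?_⟩)))
    have hc : ∀ t, play (play F false s j x) false (!s) j x false t j = some x := by
      intro t
      rcases eq_or_eq_not s t with rfl | rfl
      · rw [play_of_ne (by simp), hxs]
      · rw [play_self]
    refine ⟨he', fun t => ?_, ?_, .out_dir (dir_neg he) ?_, ?_, ?_, ?_⟩
    · rw [play_of_ne (by simp), hmid]
    · rw [hc, hc]; simp
    · rw [hc, play_col (by omega), play_col (by omega), ← sub_eq_add_neg, hl]
      exact ⟨rfl, by simp⟩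
    · rwa [play_col (by omega), play_col (by omega)]
    · rwa [play_col (by omega), play_col (by omega)]
    · exact hb.imp id fun h => (h.play h1).play h2
  rcases hr : F true (!s) (j + e) with _ | r
  · rcases hpp : F true s (j - e) with _ | p
    · have hS := hF.solid_of_hasMid hle
      -- The alternative that the outer vertex on side `s` of column `j - e` has color `x` is
      -- excluded because Bob's move was legal, so the column beyond the support is as `Guarded`
      -- requires.
      have hh := (hS.half s e he hpp (by rwa [sub_add_cancel])).2
      refine houter ?_ (-e) (dir_neg he) (by rwa [← sub_eq_add_neg])
        (by rw [← sub_eq_add_neg, hl]; simp) ?_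
      · have hne := h1.dir he
        by_cases hk : In n (j + e)
        · rcases hF.good _ hk with h | h | ⟨t, e', h⟩ | ⟨t, h⟩
          · rw [h.2]; simp
          · obtain ⟨t, ht⟩ := h.hasMid
            rcases eq_or_eq_not s t with rfl | rfl
            · exact absurd hq ht
            · exact absurd hr ht
          · have := h.out.2
            cases s <;> simp_all
          · have : FullMid F j := by
              rcases he with rfl | rfl
              · simpa using h.prev
              · simpa using h.next
            exact absurd (hE.2 _ _) (this true)
        · rw [hp.outside _ _ _ hk]; simp
      · rw [show j + 2 * -e = j - e - e by ring]
        rcases hh with hh | hh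
        · rw [hl] at hh
          have := h1.dir (dir_neg he)
          rw [← sub_eq_add_neg] at this
          exact absurd hh this
        · exact hh
    · have c2 : F true (!s) (j - e) ≠ some p := by
        rw [← hpp]; exact (hp.across s _ (by simp [hpp])).symm
      refine hhalf s _ p rfl (hleg _ p e he (by simp [hr]) c2 (by simp)) (.cross_dir (dir_neg he) ?_)
        (fun e' he' h => ⟨rfl, Or.inr (by rwa [hdir e' he' h])⟩)
      rw [play_self, play_col (by omega), play_col (by omega), ← sub_eq_add_neg, hpp]
      exact ⟨rfl, by simp⟩
  · have hrm : HasMid F (j + e) := ⟨!s, by simp [hr]⟩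
    have hxr : x ≠ r := by rintro rfl; exact hrx hr
    by_cases hpr : F true s (j - e) = some r
    · have hS := hF.solid_of_hasMid hrm
      have hh := (hS.half s (-e) (dir_neg he) hq (by rwa [add_neg_cancel_right])).1
      have hout := h1.dir he
      -- If legal, `x` is played at the inner vertex on side `s` of column `j + e`: it matches Bob's
      -- vertex, and column `j` becomes enclosed. If `x` is forbidden there by column `j + 2 * e`,
      -- that column satisfies `beyond`, and the same vertex serves as a support.
      by_cases hw : F true s (j + e + e) = some x
      · refine houter ?_ e he hq (by simp [hr]) (Or.inr ⟨s, ?_⟩)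
        · rcases hh with hh | hh
          · rw [hh]; simp
          · rwa [hh]
        · rw [show j + 2 * e = j + e + e by ring, hw]; simp
      · have h2 : Leg (play F false s j x) n true s (j + e) x := by
          refine .of_dir he ?_ ?_ ?_ ?_ ?_ ?_
          · by_contra hk
            have := hp.outside true (!s) _ hk
            rw [hr] at this; simp at this
          · rwa [play_col (by omega)]
          · rwa [play_col (by omega)]
          · rw [add_sub_cancel_right, hmid]; simp
          · rwa [Bool.not_true, play_col (by omega)]
          · rw [play_col (by omega), hr]; simpa using hxr.symm
        have hfl : FullMid (play (play F false s j x) true s (j + e) x) (j - e) := by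
          intro t
          rw [play_col (by omega), play_col (by omega)]
          rcases eq_or_eq_not s t with rfl | rfl
          · simp [hpr]
          · simp [hl]
        have hfr : FullMid (play (play F false s j x) true s (j + e) x) (j + e) := by
          intro t
          rcases eq_or_eq_not s t with rfl | rfl
          · rw [play_self]; simp
          · rw [play_of_ne (by simp), play_col (by omega), hr]; simp
        have hjx : play (play F false s j x) true s (j + e) x false s j = some x := by
          rw [play_of_ne (by simp), hxs]
        refine ⟨_, _, _, _, h2, hF.of_two h1 h2 (fun k t e _ h => by simp)
          (.of_emp (dir_neg he) (by rwa [add_neg_cancel_right]))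
          (Or.inr (Or.inr (Or.inr ⟨s, .of_dir he (fun t => ?_) hfr hfl (.out_dir he ?_) ?_⟩)))
          (Or.inr (Or.inl (.of_full hfr ?_ ?_)))⟩
        · rw [play_col (by omega), hmid]
        · rw [hjx, play_self]; exact ⟨rfl, by simp⟩
        · rw [play_of_ne (by simp), hod]
        · intro g1 g2
          have : Emp (play (play F false s j x) true s (j + e) x) n j := by
            rcases he with rfl | rfl
            · simpa using g2
            · simpa using g1
          have := this.2 false s
          rw [hjx] at this; simp at this
        · intro e' he' hE' hP
          have p1 := hP s
          have p2 := hP (!s)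
          rw [Bool.not_not, play_self, play_of_ne (by simp), play_col (by omega)] at p2
          rw [play_of_ne (by simp), play_col (by omega), play_of_ne (by simp),
            play_col (by omega), hr] at p1
          rcases hh with hh | hh
          · exact p2.1 hh
          · rw [hh, p1.2] at p2
            exact hxr (by simpa using p2.2.symm)
    · refine hhalf (!s) s r (by simp) (hleg _ r e he (by simp [hq]) hpr (fun _ => hxr))
        (.cross_dir he ?_) (hvac hrm _ _)
      rw [Bool.not_not, play_self, play_col (by omega), play_col (by omega), hr]
      exact ⟨rfl, by simp⟩

/-- Bob must have played an inner vertex, so Alice colors the other one. With equal outer colors the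
full column cannot be perfect, and the support's column keeps one neighbor nonempty. -/
theorem Inv.answer_guarded {F : Board} {n : ℤ} {b s : Bool} {j : ℤ} {x : Fin 4} {t : Bool} {e : ℤ}
    (hF : Inv F n) (h1 : Leg F n b s j x) (hG : Guarded F n j t e) :
    Answer (play F b s j x) n := by
  have hm : ¬ HasMid F j := fun ⟨u, hu⟩ => hu (hG.mid u)
  have hout : ∀ u, F false u j ≠ none := by
    intro u; cases u
    · exact hG.out.2 ▸ hG.out.1
    · exact hG.out.1
  cases b with
  | false => exact absurd h1.free (hout s)
  | true =>
    have hp1 := hF.proper.play h1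
    obtain ⟨y, h2⟩ : ∃ y, Leg (play F true s j x) n true (!s) j y := by
      have h0 : play F true s j x true (!s) j = none := by rw [play_of_ne (by simp), hG.mid]
      rcases eq_or_eq_not t s with rfl | rfl
      · exact (hG.safe.mono (play_mono h1)).exists_leg hp1 h1.mem h0
      · have e0 := dir_ne hG.dir
        obtain ⟨y, c1, c2, c3⟩ := exists_color (F true t (j - e)) (F false t j) (some x)
        refine ⟨y, .of_dir hG.dir h1.mem h0 ?_ ?_ ?_ ?_⟩
        · rw [play_col (by omega), Bool.not_not, hG.support]; simp
        · rwa [play_col (by omega), Bool.not_not]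
        · rwa [play_of_ne (by simp), Bool.not_not]
        · rwa [Bool.not_not, play_self, imp_iff_right rfl]
    have hf : FullMid (play (play F true s j x) true (!s) j y) j := by
      intro u
      rcases eq_or_eq_not s u with rfl | rfl
      · rw [play_of_ne (by simp), play_self]; simp
      · rw [play_self]; simp
    have hp2 := hp1.play h2
    refine hF.answer_col h1 h2 (.of_not_hasMid hm) (.of_not_hasMid hm)
      (Or.inr (Or.inl (.of_full hf (fun g1 g2 => ?_) ?_)))
    · exfalso
      have hc : HasMid F (j + e) := ⟨_, hG.colored⟩
      rcases hG.dir with rfl | rfl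
      · exact not_emp_of_hasMid hc g1.of_play.1.of_play.1
      · exact not_emp_of_hasMid hc g2.of_play.1.of_play.1
    · intro e' _ _ hP
      have p1 := (hP true).2
      have p2 := (hP false).2
      rw [play_of_ne (by simp), play_of_ne (by simp), hG.out.2] at p1
      rw [play_of_ne (by simp), play_of_ne (by simp)] at p2
      exact hp2.across true j (hf _) (p2.symm.trans p1)

theorem Inv.answer_enclosed {F : Board} {n : ℤ} {b s : Bool} {j : ℤ} {x : Fin 4} {t : Bool}
    (hF : Inv F n) (h1 : Leg F n b s j x) (hQ : Enclosed F j t)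
    (hne : ∃ b' s' k, In n k ∧ play F b s j x b' s' k = none) :
    Answer (play F b s j x) n := by
  have hm : ¬ HasMid F j := fun ⟨u, hu⟩ => hu (hQ.mid u)
  have hvac : ∀ e, e = 1 ∨ e = -1 → ¬ Emp F n (j + e) := by
    rintro e (rfl | rfl)
    · exact not_emp_of_hasMid (.of_full hQ.next)
    · exact not_emp_of_hasMid (.of_full hQ.prev)
  rcases eq_or_eq_not t s with rfl | rfl
  · cases b with
    | false =>
      refine hF.answer_free h1 .outer (Or.inr (Or.inr (Or.inr ⟨s, ?_⟩))) hne
      refine ⟨fun u => ?_, hQ.next.play h1, hQ.prev.play h1, hQ.safe.mono (play_mono h1), ?_⟩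
      · rw [play_of_ne (by simp), hQ.mid]
      · rw [play_of_ne (by simp), hQ.out]
    | true =>
      obtain ⟨y, c1, c2, c3⟩ := exists_color (F true (!s) (j + 1)) (F true (!s) (j - 1)) (some x)
      have h2 : Leg (play F true s j x) n true (!s) j y := by
        refine ⟨h1.mem, ?_, ?_, ?_, ?_, ?_⟩
        · rw [play_of_ne (by simp), hQ.mid]
        · rwa [play_col (by omega)]
        · rwa [play_col (by omega)]
        · rw [play_of_ne (by simp), Bool.not_true, hQ.out]; simp
        · rwa [Bool.not_not, play_self, imp_iff_right rfl]
      refine hF.answer_col h1 h2 (.of_not_hasMid hm) (.of_not_hasMid hm)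
        (Or.inr (Or.inl (.of_full (fun u => ?_) (fun g _ => ?_) fun e he g => ?_)))
      · rcases eq_or_eq_not s u with rfl | rfl
        · rw [play_of_ne (by simp), play_self]; simp
        · rw [play_self]; simp
      · exact absurd g.of_play.1.of_play.1 (hvac 1 (Or.inl rfl))
      · exact absurd g.of_play.1.of_play.1 (hvac e he)
  · cases b with
    | false =>
      obtain ⟨y, c1, c2, c3⟩ := exists_color (F true (!t) (j + 1)) (F true (!t) (j - 1)) (some x)
      have h2 : Leg (play F false (!t) j x) n true (!t) j y := by
        refine ⟨h1.mem, ?_, ?_, ?_, ?_, ?_⟩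
        · rw [play_of_ne (by simp), hQ.mid]
        · rwa [play_col (by omega)]
        · rwa [play_col (by omega)]
        · rwa [Bool.not_true, play_self]
        · rw [play_of_ne (by simp), hQ.mid]; simp
      refine hF.answer_col h1 h2 .outer (.of_not_hasMid hm)
        (Or.inr (Or.inl (.of_half (s := t) ?_ ?_ ?_ fun e he g => ?_)))
      · rw [play_of_ne (by simp), play_of_ne (by simp), hQ.mid]
      · rw [play_self]; simp
      · exact (hQ.safe.mono (play_mono h1)).mono (play_mono h2)
      · exact absurd g.of_play.1.of_play.1 (hvac e he)
    | true =>
      exact hF.answer_free h1 (.of_not_hasMid hm) (Or.inr (Or.inl (hQ.solid_of_weak h1))) hne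

/-- Alice answers at an outer vertex between two empty columns with a color foreign to the inner
vertices. -/
theorem Inv.answer_broken {F : Board} {n : ℤ} {b s u : Bool} {j : ℤ} {x : Fin 4}
    (hF : Inv F n) (h1 : Leg F n b s j x) (ns : NoSupport F n b s j)
    (hf : FullMid (play F b s j x) j) (hE : Emp F n (j + 1)) (hE' : Emp F n (j - 1))
    (h0 : play F b s j x false u j = none) : Answer (play F b s j x) n := by
  obtain ⟨y, c1, c2, -⟩ := exists_color (play F b s j x true u j) (play F b s j x true (!u) j) none
  have h2 : Leg (play F b s j x) n false u j y := by
    refine ⟨h1.mem, h0, ?_, ?_, c1, by simp⟩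
    · rw [play_col (by omega), hE.2]; simp
    · rw [play_col (by omega), hE'.2]; simp
  have hB : Broken (play (play F b s j x) false u j y) j := by
    refine ⟨u, by rw [play_self]; simp, fun t => ?_⟩
    rw [play_self, play_of_ne (by simp)]
    rcases eq_or_eq_not u t with rfl | rfl
    · exact c1.symm
    · exact c2.symm
  exact hF.answer_col h1 h2 ns .outer
    (Or.inr (Or.inl (.of_full (hf.play h2) (fun _ _ => Or.inl hB) fun _ _ _ => hB.not_perfect)))

/-- If Bob takes a support, Alice at once colors the guarded vertex. Otherwise only a column between
two empty ones needs care, and there `half` has kept an outer vertex free with which to break it. -/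
theorem Inv.answer_solid_inner {F : Board} {n : ℤ} {s : Bool} {j : ℤ} {x : Fin 4}
    (hF : Inv F n) (h1 : Leg F n true s j x) (hS : Solid F n j)
    (hne : ∃ b' s' k, In n k ∧ play F true s j x b' s' k = none) :
    Answer (play F true s j x) n := by
  have hf := hS.fullMid_play h1
  by_cases hns : NoSupport F n true s j
  · by_cases hE : Emp F n (j + 1) ∧ Emp F n (j - 1)
    · have hm : ¬ HasMid F (j - 1) := fun h => not_emp_of_hasMid h hE.2
      have h3 := hS.half s 1 (Or.inl rfl) h1.free hE.1
      have h4 : F false s j = F true (!s) j := by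
        rcases h3.2 with h | h | h
        · exact h
        · exact absurd hE.2.1 h
        · exact absurd h hm
      have h5 : F false (!s) j = none := by
        by_contra h5
        have := hF.proper.cross false (!s) j h5
        rcases h3.1 with h | h
        · exact h5 h
        · exact this (h.trans h4)
      refine hF.answer_broken h1 hns hf hE.1 hE.2 (u := !s) ?_
      rw [play_of_ne (by simp), h5]
    · refine hF.answer_free h1 hns (Or.inr (Or.inl (.of_full hf ?_ ?_))) hne
      · intro g1 g2; exact absurd ⟨g1.of_play.1, g2.of_play.1⟩ hE
      · intro e he g; exact hS.not_perfect_play hF.proper h1 he g.of_play.1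
  · unfold NoSupport at hns
    push Not at hns
    obtain ⟨k, t, e, hG, -, rfl, rfl⟩ := hns
    have e0 := dir_ne hG.dir
    have hk := hG.mem hF.proper
    obtain ⟨y, c1, c2, c3⟩ := exists_color (F true s (k - e)) (F false s k) (some x)
    have hmid : ∀ u, play F true s (k + e) x true u k = none := fun u => by
      rw [play_col (by omega), hG.mid]
    have h2 : Leg (play F true s (k + e) x) n true s k y := by
      refine .of_dir hG.dir hk (hmid _) ?_ ?_ ?_ ?_
      · rwa [play_self]
      · rwa [play_col (by omega)]
      · rwa [play_col (by omega)]
      · rw [hmid]; simp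
    have hout : play F true s (k + e) x false true k = play F true s (k + e) x false false k := by
      rw [play_col (by omega), play_col (by omega), hG.out.2]
    have hvac : ∀ e', e' = 1 ∨ e' = -1 → ¬ Emp F n (k + e + e') := by
      intro e' he' h
      have hd := hG.dir
      have : e' = e ∨ e' = -e := by omega
      rcases this with rfl | rfl
      · rw [add_assoc, ← two_mul] at h
        rcases hG.beyond with h' | h'
        · exact h' h.1
        · exact not_emp_of_hasMid h' h
      · rw [add_neg_cancel_right] at h
        exact hG.out.1 (h.2 _ _)
    refine ⟨_, _, _, _, h2, hF.of_two h1 h2 ?_ (.of_not_hasMid fun ⟨u, hu⟩ => hu (hG.mid u))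
      (Or.inr (Or.inl (.of_full (hf.play h2) ?_ ?_)))
      (Or.inr (Or.inl (solid_of_weak hG.dir hmid hout (hG.safe.mono (play_mono h1)) (.of_full hf)
        h2)))⟩
    -- A vertex cannot support two guarded columns: the second would be `k + 2 * e`, contradicting
    -- `beyond`.
    · rintro k' t e' hk' hG' ⟨-, rfl, h⟩
      have hd := hG.dir
      have hd' := hG'.dir
      have : k' = k + 2 * e := by omega
      subst this
      rcases hG.beyond with h' | ⟨u, hu⟩
      · exact h' (hG'.mem hF.proper)
      · exact hu (hG'.mid u)
    · intro g; exact absurd g.of_play.1.of_play.1 (hvac 1 (Or.inl rfl))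
    · intro e' he' g; exact absurd g.of_play.1.of_play.1 (hvac e' he')

theorem Inv.answer_solid_outer_of_full {F : Board} {n : ℤ} {s : Bool} {j : ℤ} {x : Fin 4}
    (hF : Inv F n) (h1 : Leg F n false s j x) (hS : Solid F n j) (hf : FullMid F j)
    (hne : ∃ b' s' k, In n k ∧ play F false s j x b' s' k = none) :
    Answer (play F false s j x) n := by
  by_cases hE : Emp F n (j + 1) ∧ Emp F n (j - 1)
  · rcases hS.broken hf hE.1 hE.2 with ⟨u, hu, hB⟩ | hB
    · have hB : Broken (play F false s j x) j := by
        refine ⟨u, by rwa [play_mono h1 _ _ _ hu], fun t => ?_⟩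
        rw [play_mono h1 _ _ _ hu, play_of_ne (by simp)]
        exact hB t
      exact hF.answer_free h1 .outer (Or.inr (Or.inl (.of_full (hf.play h1)
        (fun _ _ => Or.inl hB) fun _ _ _ => hB.not_perfect))) hne
    · refine hF.answer_broken h1 .outer (hf.play h1) hE.1 hE.2 (u := !s) ?_
      rw [play_of_ne (by simp), hB]
  · by_cases hP : ∃ e, (e = 1 ∨ e = -1) ∧ Emp F n (j + e) ∧ Perfect (play F false s j x) j
    · obtain ⟨e, he, hEe, hP⟩ := hP
      have e0 := dir_ne he
      have hm : ¬ HasMid F (j + e) := fun h => not_emp_of_hasMid h hEe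
      have hjk : j + e - e = j := by ring
      suffices h : ∃ b' s' y, Leg (play F false s j x) n b' s' (j + e) y ∧
          Inv (play (play F false s j x) b' s' (j + e) y) n by
        obtain ⟨b', s', y, h⟩ := h
        exact ⟨_, _, _, _, h⟩
      -- Bob has made column `j` perfect beside an empty column. Once Alice opens that one, column
      -- `j` has no empty neighbor and is solid again. The column on the far side is not perfect,
      -- since it bordered an empty column under the invariant.
      refine exists_reply_of_emp (k := j + e) he (hF.proper.play h1) ⟨hEe.1, fun b' s' => ?_⟩
        ?_ ?_ ?_ ?_
      · rw [play_col (by omega), hEe.2]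
      · intro i hi _ hij
        exact (hF.good i hi).play_ne h1 (by omega) fun t e' => NoSupport.outer i t e'
      · intro b' s' y h2
        rw [hjk]
        refine Or.inr (Or.inl (.of_full ((hf.play h1).play h2) (fun g1 g2 => ?_) ?_))
        · exact absurd ⟨g1.of_play.1.of_play.1, g2.of_play.1.of_play.1⟩ hE
        · intro e' he' g
          exfalso
          have h3 := g.of_play.2
          have h4 := g.of_play.1.of_play.1
          have : e' = -e := by omega
          subst this
          rcases he with rfl | rfl
          · exact hE ⟨hEe, h4⟩
          · exact hE ⟨by simpa using h4, hEe⟩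
      · rw [hjk]; exact hf.play h1
      · rintro ⟨-, hQ⟩
        have hQ' : Perfect F (j + e + e) := by
          intro u
          have := hQ u
          rwa [play_col (by omega), play_col (by omega)] at this
        have hmQ : HasMid F (j + e + e) := ⟨!true, by rw [← (hQ' true).2]; exact (hQ' true).1⟩
        refine (hF.solid_of_hasMid hmQ).perfect (-e) (dir_neg he) ?_ hQ'
        rwa [add_neg_cancel_right]
    · refine hF.answer_free h1 .outer (Or.inr (Or.inl (.of_full (hf.play h1) ?_ ?_))) hne
      · intro g1 g2; exact absurd ⟨g1.of_play.1, g2.of_play.1⟩ hE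
      · intro e he g h; exact hP ⟨e, he, g.of_play.1, h⟩

theorem Inv.answer_solid_outer_of_half {F : Board} {n : ℤ} {s t : Bool} {j : ℤ} {x : Fin 4}
    (hF : Inv F n) (h1 : Leg F n false s j x) (hS : Solid F n j) (h0 : F true t j = none)
    (hne : ∃ b' s' k, In n k ∧ play F false s j x b' s' k = none) :
    Answer (play F false s j x) n := by
  have hc := hS.colored h0
  have h0' : play F false s j x true t j = none := by rw [play_of_ne (by simp), h0]
  have hc' : play F false s j x true (!t) j = F true (!t) j := by rw [play_of_ne (by simp)]
  have hsafe := (hS.safe t h0).mono (play_mono h1)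
  have free : (∀ e, e = 1 ∨ e = -1 → Emp F n (j + e) →
      play F false s j x false (!t) j = none ∨
        play F false s j x false (!t) j = play F false s j x false t j) →
      Answer (play F false s j x) n := by
    intro h
    refine hF.answer_free h1 .outer (Or.inr (Or.inl (.of_half (s := t) h0' (by rwa [hc']) hsafe
      fun e he g => ⟨h e he g.of_play.1, ?_⟩))) hne
    rcases (hS.half t e he h0 g.of_play.1).2 with h' | h' | h'
    · left; rw [hc', play_mono h1 _ _ _ (h' ▸ hc), h']
    · exact Or.inr (Or.inl h')
    · exact Or.inr (Or.inr (h'.play h1))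
  rcases eq_or_eq_not t s with rfl | rfl
  · refine free fun e he g => Or.inl ?_
    rw [play_of_ne (by simp)]
    rcases (hS.half s e he h0 g).1 with h | h
    · exact h
    · rw [h, h1.free]
  -- Only the first part of `half` can have failed. Then Alice fills the missing inner vertex on
  -- side `t`.
  by_cases hE : ∀ e, e = 1 ∨ e = -1 → Emp F n (j + e) → F false t j = some x
  · refine free fun e he g => Or.inr ?_
    rw [play_self, play_of_ne (by simp), hE e he g]
  push Not at hE
  obtain ⟨e, he, hEe, hx⟩ := hE
  have e0 := dir_ne he
  have ha : play F false (!t) j x false t j = F false t j := by rw [play_of_ne (by simp)]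
  have hxc : F true (!t) j ≠ some x := by simpa using h1.cross
  have reply : ∀ y, F true t (j - e) ≠ some y → F false t j ≠ some y → F true (!t) j ≠ some y →
      ((Emp F n (j + 1) → Emp F n (j - 1) → False) ∧ F false t j ≠ F true (!t) j ∨ x ≠ y) →
      Answer (play F false (!t) j x) n := by
    intro y c1 c2 c3 c4
    have h2 : Leg (play F false (!t) j x) n true t j y := by
      refine .of_dir he h1.mem h0' ?_ ?_ ?_ ?_
      · rw [play_col (by omega), hEe.2]; simp
      · rwa [play_col (by omega)]
      · rwa [Bool.not_true, ha]
      · rwa [hc', imp_iff_right rfl]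
    refine hF.answer_col h1 h2 .outer (.of_emp he hEe) (Or.inr (Or.inl ?_))
    have hf : FullMid (play (play F false (!t) j x) true t j y) j := by
      intro u
      rcases eq_or_eq_not t u with rfl | rfl
      · rw [play_self]; simp
      · rwa [play_of_ne (by simp), hc']
    rcases c4 with ⟨c4, c5⟩ | c4
    · refine .of_full hf (fun g1 g2 => ?_) fun _ _ _ h => ?_
      · exact absurd g2.of_play.1.of_play.1 (c4 g1.of_play.1.of_play.1)
      · have := (h t).2
        rw [play_of_ne (by simp), ha, play_of_ne (by simp), hc'] at this
        exact c5 this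
    · have hB : Broken (play (play F false (!t) j x) true t j y) j := by
        refine ⟨!t, ?_, fun u => ?_⟩
        · rw [play_of_ne (by simp), play_self]; simp
        · rw [play_of_ne (by simp), play_self]
          rcases eq_or_eq_not t u with rfl | rfl
          · rw [play_self]; simpa using c4
          · rw [play_of_ne (by simp), hc']; exact hxc.symm
      exact .of_full hf (fun _ _ => Or.inl hB) fun _ _ _ => hB.not_perfect
  -- Here the neighbors exclude few enough colors that Alice can also avoid `x`, making Bob's outer
  -- color foreign. In the other case any legal color does: the column is not perfect on side `t`,
  -- and `half` rules out two empty neighbors.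
  by_cases hac : F false t j = none ∨ F false t j = F true (!t) j
  · obtain ⟨y, c1, c2, c3⟩ := exists_color (some x) (F true (!t) j) (F true t (j - e))
    refine reply y c3 ?_ c2 (Or.inr (by simpa using c1))
    rcases hac with h | h
    · rw [h]; simp
    · rwa [h]
  · rw [not_or] at hac
    obtain ⟨y, c1, c2, c3⟩ := exists_color (F false t j) (F true (!t) j) (F true t (j - e))
    refine reply y c3 c1 c2 (Or.inl ⟨fun g1 g2 => ?_, hac.2⟩)
    have h3 : Emp F n (j - e) := by
      rcases he with rfl | rfl
      · exact g2
      · simpa using g1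
    rcases (hS.half t e he h0 hEe).2 with h | h | h
    · exact hac.2 h
    · exact h h3.1
    · exact not_emp_of_hasMid h h3

/-- Alice can answer every move of Bob, unless it has completed the coloring. -/
theorem Inv.answer {F : Board} {n : ℤ} {b s : Bool} {j : ℤ} {x : Fin 4}
    (hF : Inv F n) (h1 : Leg F n b s j x)
    (hne : ∃ b' s' k, In n k ∧ play F b s j x b' s' k = none) :
    Answer (play F b s j x) n := by
  rcases hF.good j h1.mem with hE | hS | ⟨t, e, hG⟩ | ⟨t, hQ⟩
  · cases b with
    | false => exact hF.answer_emp_outer h1 hE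
    | true => exact hF.answer_emp_inner h1 hE
  · cases b with
    | false =>
      by_cases hf : FullMid F j
      · exact hF.answer_solid_outer_of_full h1 hS hf hne
      · unfold FullMid at hf
        push Not at hf
        obtain ⟨t, h0⟩ := hf
        exact hF.answer_solid_outer_of_half h1 hS h0 hne
    | true => exact hF.answer_solid_inner h1 hS hne
  · exact hF.answer_guarded h1 hG
  · exact hF.answer_enclosed h1 hQ hne

/-! ### From the strip to the game on the grid. -/

open SimpleGraph ColoringGame

/-- The row of the grid in which the vertices `(b, s, ·)` of the strip lie. -/
def row : Bool → Bool → Fin 4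
  | false, true => 0
  | true, true => 1
  | true, false => 2
  | false, false => 3

theorem exists_row (i : Fin 4) : ∃ b s, row b s = i := by revert i; decide

theorem row_inj {b s b' s' : Bool} : row b s = row b' s' ↔ b = b' ∧ s = s' := by
  revert b s b' s'; decide

theorem row_adj {b s b' s' : Bool} : (pathGraph 4).Adj (row b s) (row b' s') ↔
    (b' = !b ∧ s' = s) ∨ (b = true ∧ b' = true ∧ s' = !s) := by
  rw [pathGraph_adj]
  revert b s b' s'; decide

/-- The board of a partial coloring of the grid. -/
def board {n : ℕ} (c : Fin 4 × Fin n → Option (Fin 4)) : Board :=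
  fun b s k => if h : 0 ≤ k ∧ k < n then c (row b s, ⟨k.toNat, by omega⟩) else none

theorem board_coe {n : ℕ} (c : Fin 4 × Fin n → Option (Fin 4)) (b s : Bool) (m : Fin n) :
    board c b s (m : ℕ) = c (row b s, m) := by
  have := m.isLt
  rw [board, dif_pos (by omega)]
  rfl

theorem board_of_not_in {n : ℕ} (c : Fin 4 × Fin n → Option (Fin 4)) (b s : Bool) {k : ℤ}
    (h : ¬ In n k) : board c b s k = none := dif_neg h

theorem In.exists_fin {n : ℕ} {k : ℤ} (h : In n k) : ∃ m : Fin n, ((m : ℕ) : ℤ) = k :=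
  ⟨⟨k.toNat, by unfold In at h; omega⟩, by unfold In at h; simpa using h.1⟩

theorem isLegal_iff_leg {n : ℕ} {h : History (Fin 4 × Fin n) 4} {b s : Bool} {m : Fin n}
    {x : Fin 4} : IsLegal (pathGraph 4 □ pathGraph n) h ((row b s, m), x) ↔
      Leg (board (coloring h)) n b s (m : ℕ) x := by
  have hm := m.isLt
  constructor
  · rintro ⟨h1, h2⟩
    have side : ∀ k : ℤ, k = (m : ℕ) + 1 ∨ k = (m : ℕ) - 1 →
        board (coloring h) b s k ≠ some x := by
      intro k hk
      by_cases hkn : In n k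
      · obtain ⟨m', rfl⟩ := hkn.exists_fin
        rw [board_coe]
        refine h2 _ (boxProd_adj.2 (Or.inr ⟨pathGraph_adj.2 ?_, rfl⟩))
        show (m : ℕ) + 1 = m' ∨ (m' : ℕ) + 1 = m
        omega
      · rw [board_of_not_in _ _ _ hkn]; simp
    refine ⟨by unfold In; omega, by rwa [board_coe], side _ (Or.inl rfl), side _ (Or.inr rfl),
      ?_, ?_⟩
    · rw [board_coe]
      exact h2 _ (boxProd_adj.2 (Or.inl ⟨row_adj.2 (Or.inl ⟨rfl, rfl⟩), rfl⟩))
    · rintro rfl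
      rw [board_coe]
      exact h2 _ (boxProd_adj.2 (Or.inl ⟨row_adj.2 (Or.inr ⟨rfl, rfl, rfl⟩), rfl⟩))
  · intro hl
    refine ⟨by rw [← board_coe (coloring h)]; exact hl.free, ?_⟩
    rintro ⟨i, m'⟩ hadj
    obtain ⟨b', s', rfl⟩ := exists_row i
    rw [← board_coe (coloring h)]
    rcases boxProd_adj.1 hadj with ⟨ha, hb⟩ | ⟨ha, hb⟩
    · obtain rfl : m = m' := hb
      rcases row_adj.1 ha with ⟨rfl, rfl⟩ | ⟨rfl, rfl, rfl⟩
      · exact hl.cross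
      · exact hl.across rfl
    · obtain ⟨rfl, rfl⟩ := row_inj.1 hb
      have ha : (m : ℕ) + 1 = m' ∨ (m' : ℕ) + 1 = m := pathGraph_adj.1 ha
      rcases ha with ha | ha
      · rw [← ha]; exact_mod_cast hl.next
      · have : ((m' : ℕ) : ℤ) = (m : ℕ) - 1 := by omega
        rw [this]; exact hl.prev

theorem board_cons {n : ℕ} (h : History (Fin 4 × Fin n) 4) (b s : Bool) (m : Fin n) (x : Fin 4) :
    board (coloring (((row b s, m), x) :: h)) = play (board (coloring h)) b s (m : ℕ) x := by
  funext b' s' k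
  by_cases hk : In n k
  · obtain ⟨m', rfl⟩ := hk.exists_fin
    rw [board_coe, play, board_coe]
    simp only [coloring, Function.update_apply, Prod.mk.injEq, row_inj, and_assoc, Nat.cast_inj,
      Fin.val_inj]
  · have : k ≠ (m : ℕ) := by
      rintro rfl
      have := m.isLt
      unfold In at hk; omega
    rw [board_of_not_in _ _ _ hk, play_col this, board_of_not_in _ _ _ hk]

theorem Answer.exists_isLegal {n : ℕ} {h : History (Fin 4 × Fin n) 4}
    (hA : Answer (board (coloring h)) n) :
    ∃ m, IsLegal (pathGraph 4 □ pathGraph n) h m ∧ Inv (board (coloring (m :: h))) n := by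
  obtain ⟨b, s, k, x, hl, hI⟩ := hA
  obtain ⟨m, rfl⟩ := hl.mem.exists_fin
  exact ⟨_, isLegal_iff_leg.2 hl, by rwa [board_cons]⟩

theorem exists_uncolored {n : ℕ} {c : Fin 4 × Fin n → Option (Fin 4)} {v : Fin 4 × Fin n}
    (h : c v = none) : ∃ b s k, In n k ∧ board c b s k = none := by
  obtain ⟨i, m⟩ := v
  obtain ⟨b, s, rfl⟩ := exists_row i
  refine ⟨b, s, (m : ℕ), ?_, by rwa [board_coe]⟩
  have := m.isLt
  unfold In; omega

open Classical in
/-- Alice restores the invariant whenever she can. -/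
noncomputable def aliceStrategy (n : ℕ) : Strategy (pathGraph 4 □ pathGraph n) 4 := fun h hm =>
  if hI : ∃ m, IsLegal (pathGraph 4 □ pathGraph n) h m ∧ Inv (board (coloring (m :: h))) n then
    ⟨hI.choose, hI.choose_spec.1⟩
  -- A default move for histories outside the actual plays; for `1 ≤ n` those never reach it.
  else ⟨hm.choose, hm.choose_spec⟩

theorem inv_board_nil (n : ℕ) :
    Inv (board (coloring ([] : History (Fin 4 × Fin n) 4))) n := by
  have h0 : ∀ b s k, board (coloring ([] : History (Fin 4 × Fin n) 4)) b s k = none := by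
    intro b s k
    simp [board, coloring]
  refine ⟨⟨?_, ?_, ?_, fun _ _ _ _ => h0 _ _ _⟩, fun k hk => Or.inl ⟨hk, fun _ _ => h0 _ _ _⟩⟩
  · intro b s k h; exact absurd (h0 _ _ _) h
  · intro b s k h; exact absurd (h0 _ _ _) h
  · intro s k h; exact absurd (h0 _ _ _) h

/-- The empty board satisfies the invariant, so Alice's first move is an extra move; afterwards
every move of Bob is met by `Inv.answer`. -/
theorem isPlay_aliceStrategy {n : ℕ} (hn : 1 ≤ n) {h : History (Fin 4 × Fin n) 4}
    (hP : IsPlay (pathGraph 4 □ pathGraph n) (aliceStrategy n) h) :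
    (Odd h.length → Inv (board (coloring h)) n) ∧
      (Even h.length → (∀ v, coloring h v ≠ none) ∨ Answer (board (coloring h)) n) := by
  induction hP with
  | start =>
    refine ⟨by simp, fun _ => Or.inr ((inv_board_nil n).exists_move ?_)⟩
    exact exists_uncolored (v := (0, ⟨0, hn⟩)) rfl
  | alice h hm _ he ih =>
    refine ⟨fun _ => ?_, fun h' => ?_⟩
    · have hI : ∃ m, IsLegal (pathGraph 4 □ pathGraph n) h m ∧
          Inv (board (coloring (m :: h))) n := by
        rcases ih.2 he with h1 | h1
        · exact absurd hm.choose_spec.1 (h1 _)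
        · exact h1.exists_isLegal
      rw [aliceStrategy, dif_pos hI]
      exact hI.choose_spec.2
    · rw [List.length_cons, Nat.even_add_one] at h'
      exact absurd he h'
  | bob h m _ ho hm ih =>
    refine ⟨fun h' => ?_, fun _ => ?_⟩
    · rw [List.length_cons, Nat.odd_add_one] at h'
      exact absurd ho h'
    · obtain ⟨⟨i, m⟩, x⟩ := m
      obtain ⟨b, s, rfl⟩ := exists_row i
      rw [or_iff_not_imp_left]
      intro hc
      push Not at hc
      obtain ⟨v, hv⟩ := hc
      have := exists_uncolored hv
      rw [board_cons] at this ⊢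
      exact (ih.1 ho).answer (isLegal_iff_leg.1 hm) this

theorem aliceWins_four {n : ℕ} (hn : 1 ≤ n) :
    AliceWinsColoringGame (pathGraph 4 □ pathGraph n) 4 := by
  refine ⟨aliceStrategy n, fun h hP hstuck => ?_⟩
  obtain ⟨h1, h2⟩ := isPlay_aliceStrategy hn hP
  rcases Nat.even_or_odd h.length with he | ho
  · rcases h2 he with h3 | h3
    · exact h3
    · obtain ⟨m, hm, -⟩ := h3.exists_isLegal
      exact absurd hm (hstuck m)
  · rintro ⟨i, m⟩ hv
    obtain ⟨b, s, rfl⟩ := exists_row i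
    have hm : In n (m : ℕ) := by have := m.isLt; unfold In; omega
    rw [← board_coe (coloring h)] at hv
    obtain ⟨x, hl⟩ := (h1 ho).exists_leg hm hv
    exact hstuck _ (isLegal_iff_leg.2 hl)

end GridGame

/-! ### Tools for Bob on an arbitrary finite graph. -/

namespace ColoringGame

variable {V : Type*} [DecidableEq V] {G : SimpleGraph V} {k : ℕ}

theorem IsLegal.nil (m : V × Fin k) : IsLegal G [] m := ⟨rfl, fun _ _ => by simp [coloring]⟩

theorem IsLegal.cons {h : History V k} {m m' : V × Fin k} (hm : IsLegal G h m) (h1 : m.1 ≠ m'.1)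
    (h2 : G.Adj m.1 m'.1 → m'.2 ≠ m.2) : IsLegal G (m' :: h) m := by
  refine ⟨by rw [coloring, Function.update_of_ne h1]; exact hm.1, fun u hu => ?_⟩
  by_cases hum : u = m'.1
  · subst hum
    rw [coloring, Function.update_self]
    simpa using h2 hu
  · rw [coloring, Function.update_of_ne hum]
    exact hm.2 u hu

theorem IsLegal.coloring_cons {h : History V k} {m : V × Fin k} (hm : IsLegal G h m) {v : V}
    {c : Fin k} (hv : coloring h v = some c) : coloring (m :: h) v = some c := by
  rw [coloring, Function.update_of_ne, hv]
  rintro rfl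
  rw [hm.1] at hv
  simp at hv

theorem coloring_cons_self (h : History V k) (m : V × Fin k) : coloring (m :: h) m.1 = some m.2 :=
  Function.update_self ..

theorem IsPlay.exists_alice {σ : Strategy G k} {h : History V k} (hP : IsPlay G σ h)
    (he : Even h.length) (hm : ∃ m, IsLegal G h m) : ∃ m, IsLegal G h m ∧ IsPlay G σ (m :: h) :=
  ⟨_, (σ h hm).2, .alice h hm hP he⟩

theorem IsPlay.exists_cons {σ : Strategy G k} {h : History V k} (hP : IsPlay G σ h)
    (hm : ∃ m, IsLegal G h m) : ∃ m, IsLegal G h m ∧ IsPlay G σ (m :: h) := by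
  rcases Nat.even_or_odd h.length with he | ho
  · exact hP.exists_alice he hm
  · obtain ⟨m, hm⟩ := hm
    exact ⟨m, hm, .bob h m hP ho hm⟩

theorem IsPlay.proper {σ : Strategy G k} {h : History V k} (hP : IsPlay G σ h) {u v : V}
    {c : Fin k} (huv : G.Adj u v) (hu : coloring h u = some c) : coloring h v ≠ some c := by
  have step : ∀ (h : History V k) (m : V × Fin k), IsLegal G h m →
      (∀ u v c, G.Adj u v → coloring h u = some c → coloring h v ≠ some c) →
      ∀ u v c, G.Adj u v → coloring (m :: h) u = some c → coloring (m :: h) v ≠ some c := by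
    intro h m hm ih u v c huv hu hv
    rw [coloring, Function.update_apply] at hu hv
    split_ifs at hu hv with h1 h2 h2
    · exact huv.ne (h1.trans h2.symm)
    · subst h1
      exact hm.2 v huv (hv.trans hu.symm)
    · subst h2
      exact hm.2 u huv.symm (hu.trans hv.symm)
    · exact ih u v c huv hu hv
  suffices ∀ u v c, G.Adj u v → coloring h u = some c → coloring h v ≠ some c from
    this u v c huv hu
  clear huv hu
  induction hP with
  | start => intro u v c _ hu; simp [coloring] at hu
  | alice h hm _ _ ih => exact step _ _ (σ h hm).2 ih
  | bob h m _ _ hm ih => exact step _ _ hm ih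

/-- Every play can be continued until no legal move is left. -/
theorem IsPlay.exists_stuck [Fintype V] {σ : Strategy G k} {h : History V k}
    (hP : IsPlay G σ h) : ∃ h', IsPlay G σ h' ∧ (∀ m, ¬ IsLegal G h' m) ∧
      ∀ v c, coloring h v = some c → coloring h' v = some c := by
  induction hN : (Finset.univ.filter fun v => coloring h v = none).card using
    Nat.strong_induction_on generalizing h with
  | _ N ih =>
    by_cases hm : ∃ m, IsLegal G h m
    · obtain ⟨m, hm, hP'⟩ := hP.exists_cons hm
      have hlt : (Finset.univ.filter fun v => coloring (m :: h) v = none).card < N := by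
        rw [← hN]
        refine Finset.card_lt_card (Finset.ssubset_iff_of_subset ?_ |>.2 ⟨m.1, ?_, ?_⟩)
        · intro v
          simp only [Finset.mem_filter, Finset.mem_univ, true_and]
          intro hv
          by_contra hc
          obtain ⟨c, hc⟩ := Option.ne_none_iff_exists'.1 hc
          rw [hm.coloring_cons hc] at hv
          simp at hv
        · simpa using hm.1
        · intro hv
          have := (Finset.mem_filter.1 hv).2
          rw [coloring_cons_self] at this
          simp at this
      obtain ⟨h', h1, h2, h3⟩ := ih _ hlt hP' rfl
      exact ⟨h', h1, h2, fun v c hv => h3 v c (hm.coloring_cons hv)⟩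
    · exact ⟨h, hP, not_exists.1 hm, fun _ _ => id⟩

/-- If Alice's strategy is winning, then every partial coloring that arises extends to a proper
coloring of the graph. -/
theorem Strategy.IsWinning.exists_coloring [Fintype V] {σ : Strategy G k} (hσ : σ.IsWinning)
    {h : History V k} (hP : IsPlay G σ h) :
    ∃ f : V → Fin k, (∀ u v, G.Adj u v → f u ≠ f v) ∧ ∀ v c, coloring h v = some c → f v = c := by
  obtain ⟨h', h1, h2, h3⟩ := hP.exists_stuck
  choose f hf using fun v => Option.ne_none_iff_exists'.1 (hσ h' h1 h2 v)
  refine ⟨f, fun u v huv h => h1.proper huv (hf u) (h ▸ hf v), fun v c hv => ?_⟩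
  exact Option.some_injective _ ((hf v).symm.trans (h3 v c hv))

/-- Bob wins the game with three colors if he can create two distant threats. -/
theorem Strategy.IsWinning.not_double_threat [Fintype V] {σ : Strategy G 3} (hσ : σ.IsWinning)
    {h : History V 3} (hP : IsPlay G σ h) (ho : Odd h.length) {p r : V} {c d e : Fin 3}
    (hc : ∀ x, x = c ∨ x = d ∨ x = e) (hp : coloring h p = some c) (hr : IsLegal G h (r, d))
    (hde : d ≠ e) {u u' q q' : V} (hup : G.Adj u p) (hup' : G.Adj u' p) (hur : G.Adj u r)
    (hur' : G.Adj u' r) (huq : G.Adj u q) (huq' : G.Adj u' q') (hq : IsLegal G h (q, e))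
    (hq' : IsLegal G h (q', e)) (hqr : q ≠ r) (hqr' : q' ≠ r)
    (hfar : ∀ w, q = w ∨ G.Adj q w → ¬ (q' = w ∨ G.Adj q' w)) : False := by
  have hP1 := hP.bob h (r, d) ho hr
  have he1 : Even ((r, d) :: h).length := by rw [List.length_cons]; exact ho.add_one
  obtain ⟨⟨w, x⟩, hm, hP2⟩ := hP1.exists_alice he1 ⟨_, hq.cons hqr fun _ => hde⟩
  have finish : ∀ u q, G.Adj u p → G.Adj u r → G.Adj u q → IsLegal G h (q, e) → q ≠ r →
      ¬ (q = w ∨ G.Adj q w) → False := by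
    intro u q hup hur huq hq hqr hi
    rw [not_or] at hi
    have hq2 : IsLegal G ((w, x) :: (r, d) :: h) (q, e) :=
      (hq.cons hqr fun _ => hde).cons hi.1 fun h => absurd h hi.2
    have hP3 := hP2.bob _ _ (by rw [List.length_cons]; exact he1.add_one) hq2
    -- It need not be checked that `u` is uncolored: no proper completion can give `u` any of the
    -- three colors.
    obtain ⟨f, f1, f2⟩ := hσ.exists_coloring hP3
    have fp := f2 p c (hq2.coloring_cons (hm.coloring_cons (hr.coloring_cons hp)))
    have fr := f2 r d (hq2.coloring_cons (hm.coloring_cons (coloring_cons_self _ _)))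
    have fq := f2 q e (coloring_cons_self _ _)
    rcases hc (f u) with h | h | h
    · exact f1 _ _ hup (h.trans fp.symm)
    · exact f1 _ _ hur (h.trans fr.symm)
    · exact f1 _ _ huq (h.trans fq.symm)
  -- Any parry of the threat at `q`, including coloring `u` itself, lies in the closed neighborhood
  -- of `q`; `hfar` then leaves the threat at `q'` intact.
  by_cases hi : q = w ∨ G.Adj q w
  · exact finish u' q' hup' hur' huq' hq' hqr' (hfar w hi)
  · exact finish u q hup hur huq hq hqr hi

end ColoringGame

/-! ### Bob wins on the grid with fewer than four colors. -/

namespace GridGame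

open SimpleGraph ColoringGame

theorem grid_adj {n : ℕ} {i i' : Fin 4} {m m' : Fin n} :
    (pathGraph 4 □ pathGraph n).Adj (i, m) (i', m') ↔
      ((i : ℕ) + 1 = i' ∨ (i' : ℕ) + 1 = i) ∧ (m : ℕ) = m' ∨
        ((m : ℕ) + 1 = m' ∨ (m' : ℕ) + 1 = m) ∧ (i : ℕ) = i' := by
  simp only [boxProd_adj, pathGraph_adj, Fin.ext_iff]

theorem not_aliceWins_zero {n : ℕ} (hn : 1 ≤ n) :
    ¬ AliceWinsColoringGame (pathGraph 4 □ pathGraph n) 0 := by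
  rintro ⟨σ, hσ⟩
  obtain ⟨f, -⟩ := hσ.exists_coloring .start
  exact (f (0, ⟨0, hn⟩)).elim0

theorem not_aliceWins_one {n : ℕ} (hn : 1 ≤ n) :
    ¬ AliceWinsColoringGame (pathGraph 4 □ pathGraph n) 1 := by
  rintro ⟨σ, hσ⟩
  obtain ⟨f, f1, -⟩ := hσ.exists_coloring .start
  exact f1 (0, ⟨0, hn⟩) (1, ⟨0, hn⟩) (grid_adj.2 (by simp)) (Subsingleton.elim _ _)

theorem not_aliceWins_two {n : ℕ} (hn : 5 ≤ n) :
    ¬ AliceWinsColoringGame (pathGraph 4 □ pathGraph n) 2 := by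
  rintro ⟨σ, hσ⟩
  obtain ⟨⟨⟨i, m⟩, c⟩, hm, hP⟩ := IsPlay.start.exists_alice (σ := σ) (by simp)
    ⟨((0, ⟨0, by omega⟩), 0), .nil _⟩
  obtain ⟨l, r, hlr⟩ : ∃ l r : Fin n, ((m : ℕ) + 1 = l ∧ (l : ℕ) + 1 = r) ∨
      ((r : ℕ) + 1 = l ∧ (l : ℕ) + 1 = m) := by
    by_cases h : (m : ℕ) + 2 < n
    · exact ⟨⟨m + 1, by omega⟩, ⟨m + 2, h⟩, by simp⟩
    · exact ⟨⟨m - 1, by omega⟩, ⟨m - 2, by omega⟩, by simp; omega⟩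
  obtain ⟨d, hd⟩ : ∃ d : Fin 2, ∀ x, x = c ∨ x = d := by clear hm hP; revert c; decide
  -- With two colors Bob needs one move: the other color at distance two in Alice's row blocks the
  -- vertex between.
  have hr : IsLegal (pathGraph 4 □ pathGraph n) [((i, m), c)] ((i, r), d) := by
    refine (IsLegal.nil _).cons ?_ ?_
    · simp only [ne_eq, Prod.mk.injEq, Fin.ext_iff]; omega
    · intro h; have := grid_adj.1 h; omega
  obtain ⟨f, f1, f2⟩ := hσ.exists_coloring (hP.bob _ _ (by simp) hr)
  have fm := f2 (i, m) c (hr.coloring_cons (coloring_cons_self _ _))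
  have fr := f2 (i, r) d (coloring_cons_self _ _)
  rcases hd (f (i, l)) with h | h
  · exact f1 (i, l) (i, m) (grid_adj.2 (by omega)) (h.trans fm.symm)
  · exact f1 (i, l) (i, r) (grid_adj.2 (by omega)) (h.trans fr.symm)

theorem not_aliceWins_three {n : ℕ} (hn : 10 ≤ n) :
    ¬ AliceWinsColoringGame (pathGraph 4 □ pathGraph n) 3 := by
  rintro ⟨σ, hσ⟩
  have legal : ∀ {z m1 p m2 : (Fin 4 × Fin n) × Fin 3}, z.1 ≠ m1.1 →
      ¬ (pathGraph 4 □ pathGraph n).Adj z.1 m1.1 → z.1 ≠ p.1 → p.2 ≠ z.2 → z.1 ≠ m2.1 →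
      ((pathGraph 4 □ pathGraph n).Adj z.1 m2.1 → m2.2 ≠ z.2) →
      IsLegal (pathGraph 4 □ pathGraph n) [m2, p, m1] z := fun h1 h2 h3 h4 h5 h6 =>
    (((IsLegal.nil _).cons h1 fun h => absurd h h2).cons h3 fun _ => h4).cons h5 h6
  obtain ⟨⟨⟨i, m⟩, c⟩, hm, hP⟩ := IsPlay.start.exists_alice (σ := σ) (by simp)
    ⟨((0, ⟨0, by omega⟩), 0), .nil _⟩
  -- Column 2 or column 7 is at distance at least three from Alice's first move, so that move plays
  -- no further role; this is where ten columns are used.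
  obtain ⟨j, hj2, hjn, hj⟩ : ∃ j : Fin n, 2 ≤ (j : ℕ) ∧ (j : ℕ) + 2 < n ∧
      ((m : ℕ) + 3 ≤ j ∨ (j : ℕ) + 3 ≤ m) := by
    by_cases h : 5 ≤ (m : ℕ)
    · exact ⟨⟨2, by omega⟩, by simp; omega⟩
    · exact ⟨⟨7, by omega⟩, by simp; omega⟩
  have hp : IsLegal (pathGraph 4 □ pathGraph n) [((i, m), c)] ((1, j), 0) := by
    refine (IsLegal.nil _).cons ?_ ?_
    · simp only [ne_eq, Prod.mk.injEq, Fin.ext_iff]; omega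
    · intro h; have := grid_adj.1 h; omega
  have hP2 := hP.bob _ _ (by simp) hp
  have hw0 : ∃ w, IsLegal (pathGraph 4 □ pathGraph n) [((1, j), 0), ((i, m), c)] w := by
    refine ⟨((0, j), 1), ((IsLegal.nil _).cons ?_ ?_).cons ?_ ?_⟩
    · simp only [ne_eq, Prod.mk.injEq, Fin.ext_iff]; omega
    · intro h; have := grid_adj.1 h; omega
    · simp
    · simp
  obtain ⟨⟨⟨i', m'⟩, x⟩, hw, hP3⟩ := hP2.exists_alice ⟨1, rfl⟩ hw0
  have hpw := hw.coloring_cons (coloring_cons_self [((i, m), c)] ((1, j), 0))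
  -- The threatening color `e` differs from the color Alice has just used, so her vertex does not
  -- forbid it nearby; `r` below lies in the column on the side of `j` away from that vertex.
  obtain ⟨d, e, hd0, he0, hde, hxe, hall⟩ : ∃ d e : Fin 3, 0 ≠ d ∧ 0 ≠ e ∧ d ≠ e ∧ x ≠ e ∧
      ∀ y : Fin 3, y = 0 ∨ y = d ∨ y = e := by
    clear hw hP3 hpw; revert x; decide
  obtain ⟨l, r, hlr⟩ : ∃ l r : Fin n,
      ((l : ℕ) + 1 = j ∧ (j : ℕ) + 1 = r ∧ (m' : ℕ) ≤ j) ∨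
        ((r : ℕ) + 1 = j ∧ (j : ℕ) + 1 = l ∧ (j : ℕ) < m') := by
    by_cases h : (m' : ℕ) ≤ j
    · exact ⟨⟨j - 1, by omega⟩, ⟨j + 1, by omega⟩, by simp; omega⟩
    · exact ⟨⟨j + 1, by omega⟩, ⟨j - 1, by omega⟩, by simp; omega⟩
  have hodd : Odd [((i', m'), x), ((1, j), 0), ((i, m), c)].length := ⟨1, rfl⟩
  have v0 : ((0 : Fin 4) : ℕ) = 0 := rfl
  have v1 : ((1 : Fin 4) : ℕ) = 1 := rfl
  have v2 : ((2 : Fin 4) : ℕ) = 2 := rfl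
  have v3 : ((3 : Fin 4) : ℕ) = 3 := rfl
  -- Bob attacks diagonally downwards from `(1, j)`, unless Alice has played below it in column `j`;
  -- then he attacks upwards.
  by_cases hcase : (m' : ℕ) = j ∧ 2 ≤ (i' : ℕ)
  · refine hσ.not_double_threat hP3 hodd (r := (0, r)) (d := d) (e := e) (u := (0, j))
      (u' := (1, r)) (q := (0, l)) (q' := (2, r)) hall hpw (legal ?_ ?_ ?_ hd0 ?_ ?_) hde ?_ ?_ ?_ ?_ ?_ ?_
      (legal ?_ ?_ ?_ he0 ?_ fun _ => hxe) (legal ?_ ?_ ?_ he0 ?_ fun _ => hxe) ?_ ?_ ?_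
    all_goals
      simp only [Prod.forall, ne_eq, grid_adj, Prod.mk.injEq, Fin.ext_iff, v0, v1, v2,
        true_or, or_true, and_true]
      try omega
  · refine hσ.not_double_threat hP3 hodd (r := (2, r)) (d := d) (e := e) (u := (2, j))
      (u' := (1, r)) (q := (3, j)) (q' := (0, r)) hall hpw (legal ?_ ?_ ?_ hd0 ?_ ?_) hde ?_ ?_ ?_ ?_ ?_ ?_
      (legal ?_ ?_ ?_ he0 ?_ fun _ => hxe) (legal ?_ ?_ ?_ he0 ?_ fun _ => hxe) ?_ ?_ ?_
    all_goals
      simp only [Prod.forall, ne_eq, grid_adj, Prod.mk.injEq, Fin.ext_iff, v0, v1, v2, v3,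
        true_or, or_true, and_true]
      try omega

theorem gameChromaticNumber_eq_four {n : ℕ} (hn : 10 ≤ n) :
    gameChromaticNumber (pathGraph 4 □ pathGraph n) = 4 := by
  refine le_antisymm (Nat.sInf_le (aliceWins_four (by omega))) ?_
  refine le_csInf ⟨4, aliceWins_four (by omega)⟩ fun k hk => ?_
  by_contra hlt
  have h0 := not_aliceWins_zero (n := n) (by omega)
  have h1 := not_aliceWins_one (n := n) (by omega)
  have h2 := not_aliceWins_two (n := n) (by omega)
  have h3 := not_aliceWins_three hn
  -- Every smaller number of colors is excluded separately, since no monotonicity of the game in `k`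
  -- is used.
  obtain rfl | rfl | rfl | rfl : k = 0 ∨ k = 1 ∨ k = 2 ∨ k = 3 := by omega
  exacts [h0 hk, h1 hk, h2 hk, h3 hk]

end GridGame

theorem mainTheorem1 :
    (∀ n : ℕ, 1 ≤ n →
      AliceWinsColoringGame (SimpleGraph.pathGraph 4 □ SimpleGraph.pathGraph n) 4 ∧
      gameChromaticNumber (SimpleGraph.pathGraph 4 □ SimpleGraph.pathGraph n) ≤ 4) ∧
    (∀ n : ℕ, 18 ≤ n →
      gameChromaticNumber (SimpleGraph.pathGraph 4 □ SimpleGraph.pathGraph n) = 4) := by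
  exact ⟨fun _ hn => ⟨GridGame.aliceWins_four hn, Nat.sInf_le (GridGame.aliceWins_four hn)⟩,
    fun _ hn => GridGame.gameChromaticNumber_eq_four (by omega)⟩
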